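/- Let $Q$ be a finite quiver (loops and multiple edges allowed) with vertex set $I$ and edge set $E$, and let $\mathbb{F}=\mathbb{Q}(q,t_e)_{e\in E}$ be the field of rational functions in independent variables $q$ and $t_e$. For $\boldsymbol{n}=(n_i)_{i\in I}\in\mathbb{N}^I$ let $\mathcal{V}_{\boldsymbol n}$ be the space of Laurent polynomials over $\mathbb{F}$ in variables $z_{ia}$ ($i\in I$, $1\le a\le n_i$) that are symmetric in $z_{i1},\dots,z_{in_i}$ for each $i$ separately. Let $\mathcal{S}_{\boldsymbol n}\subset\mathcal{V}_{\boldsymbol n}$ be the subspace of those $R$ that satisfy the wheel conditions $$R\Big|_{z_{ia}=\frac{q z_{jb}}{t_e}=q z_{ic}}=R\Big|_{z_{ja}=t_e z_{ib}=q z_{jc}}=0$$ for every edge $e=\overrightarrow{ij}$ and all $a\ne c$ (and further $a\ne b\ne c$ if $i=j$). Put $$\zeta'_{ij}(x)=\left(\frac{1-xq^{-1}}{1-x}\right)^{\delta^i_j}\prod_{e=\overrightarrow{ij}\in E}\left(\frac1{t_e}-x\right)\prod_{e=\overrightarrow{ji}\in E}\left(1-\frac{t_e}{qx}\right).$$ Let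 $\mathcal{S}'=\bigoplus_{\boldsymbol n\in\mathbb{N}^I}\mathcal{S}_{\boldsymbol n}$, with the shuffle product defined for $R$ of degree $\boldsymbol n$ and $R'$ of degree $\boldsymbol n'$ by $$R*R'=\mathrm{Sym}\left[\frac{R(\dots,z_{i1},\dots,z_{in_i},\dots)\,R'(\dots,z_{i,n_i+1},\dots,z_{i,n_i+n'_i},\dots)}{\prod_{i\in I}n_i!\,\prod_{i\in I}n'_i!}\prod_{i,j\in I}\ \prod_{\substack{1\le a\le n_i\\ n_j<b\le n_j+n'_j}}\zeta'_{ij}\left(\frac{z_{ia}}{z_{jb}}\right)\right],$$ where $\mathrm{Sym}$ is the sum over all permutations of $z_{i1},\dots,z_{i,n_i+n'_i}$ for each $i$ separately. For $i\in I$ and $d\in\mathbb{Z}$ let $e_{i,d}=z_{i1}^d$, an element of degree $\boldsymbol{\varsigma}_i=(0,\dots,0,1,0,\dots,0)$ (with $1$ in the $i$-th place). Let $\mathring{\mathcal{S}}'$ be the unital subalgebra generated by $\{e_{i,d}\}_{i\in I,\,d\in\mathbb{Z}}$, i.e. the smallest $\mathbb{F}$-subspace that contains $1$ and all $e_{i,d}$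 and is closed under $*$. Then $\mathring{\mathcal{S}}'=\mathcal{S}'$. -/

import Mathlib

open scoped DirectSum

universe u v

namespace QuiverShuffle

section Parameters

variable (I : Type u) [Quiver.{v} I]

/-- The field `𝔽 = ℚ(q, t_e)` of rational functions in a parameter `q` and one parameter `t_e`
for every edge `e` of the quiver (`none` indexes `q`, `some e` indexes `t_e`). -/
def ParamField : Type (max u v) := FractionRing (MvPolynomial (Option (Quiver.Total I)) ℚ)

noncomputable instance : Field (ParamField I) :=
  inferInstanceAs (Field (FractionRing (MvPolynomial (Option (Quiver.Total I)) ℚ)))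

noncomputable instance : Algebra (MvPolynomial (Option (Quiver.Total I)) ℚ) (ParamField I) :=
  inferInstanceAs (Algebra _ (FractionRing (MvPolynomial (Option (Quiver.Total I)) ℚ)))

instance : IsFractionRing (MvPolynomial (Option (Quiver.Total I)) ℚ) (ParamField I) :=
  inferInstanceAs (IsFractionRing _ (FractionRing (MvPolynomial (Option (Quiver.Total I)) ℚ)))

theorem algebraMap_X_ne_zero (o : Option (Quiver.Total I)) :
    algebraMap (MvPolynomial (Option (Quiver.Total I)) ℚ) (ParamField I) (MvPolynomial.X o) ≠ 0 :=
  (map_ne_zero_iff _ (IsFractionRing.injective _ _)).2 (MvPolynomial.X_ne_zero o)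

/-- The parameter `q`, as a nonzero element of `𝔽`. -/
noncomputable def q : (ParamField I)ˣ :=
  Units.mk0 (algebraMap _ _ (MvPolynomial.X none)) (algebraMap_X_ne_zero I none)

variable {I}

/-- The parameter `t_e` of an edge `e`, as a nonzero element of `𝔽`. -/
noncomputable def t {i j : I} (e : i ⟶ j) : (ParamField I)ˣ :=
  Units.mk0 (algebraMap _ _ (MvPolynomial.X (some ⟨i, j, e⟩))) (algebraMap_X_ne_zero I _)

end Parameters

section Functions

variable {I : Type u} [Quiver.{v} I]

/-- The index set of the variables `z_{ia}`, `i ∈ I`, `1 ≤ a ≤ n_i` (here `a` runs over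
`0, …, n_i - 1`). -/
abbrev VarIdx (n : I → ℕ) : Type u := Σ i : I, Fin (n i)

/-- Laurent polynomials `𝔽[…, z_{ia}^{±1}, …]`, as the group algebra of the lattice of
exponents. -/
abbrev Laurent (n : I → ℕ) : Type (max u v) :=
  AddMonoidAlgebra (ParamField I) (VarIdx n →₀ ℤ)

/-- Rational functions `𝔽(…, z_{ia}, …)`. -/
def RatFun (n : I → ℕ) : Type (max u v) := FractionRing (MvPolynomial (VarIdx n) (ParamField I))

noncomputable instance (n : I → ℕ) : Field (RatFun n) :=
  inferInstanceAs (Field (FractionRing (MvPolynomial (VarIdx n) (ParamField I))))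

noncomputable instance (n : I → ℕ) : Algebra (MvPolynomial (VarIdx n) (ParamField I)) (RatFun n) :=
  inferInstanceAs (Algebra _ (FractionRing (MvPolynomial (VarIdx n) (ParamField I))))

noncomputable instance (n : I → ℕ) : Algebra (ParamField I) (RatFun n) :=
  inferInstanceAs (Algebra _ (FractionRing (MvPolynomial (VarIdx n) (ParamField I))))

instance (n : I → ℕ) :
    IsScalarTower (ParamField I) (MvPolynomial (VarIdx n) (ParamField I)) (RatFun n) :=
  inferInstanceAs (IsScalarTower _ _ (FractionRing (MvPolynomial (VarIdx n) (ParamField I))))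

instance (n : I → ℕ) : IsFractionRing (MvPolynomial (VarIdx n) (ParamField I)) (RatFun n) :=
  inferInstanceAs (IsFractionRing _ (FractionRing (MvPolynomial (VarIdx n) (ParamField I))))

/-- The variable `z_{ia}`, as a nonzero rational function. -/
noncomputable def z {n : I → ℕ} (x : VarIdx n) : (RatFun n)ˣ :=
  Units.mk0 (algebraMap (MvPolynomial (VarIdx n) (ParamField I)) _ (MvPolynomial.X x))
    ((map_ne_zero_iff _ (IsFractionRing.injective _ _)).2 (MvPolynomial.X_ne_zero x))

/-- A nonzero scalar of `𝔽`, as a nonzero rational function. -/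
noncomputable def scal (n : I → ℕ) (c : (ParamField I)ˣ) : (RatFun n)ˣ :=
  Units.map (algebraMap (ParamField I) (RatFun n)).toMonoidHom c

/-- Substitution of nonzero rational functions `w x` for the variables of a Laurent polynomial. -/
noncomputable def subst {n m : I → ℕ} (w : VarIdx n → (RatFun m)ˣ) :
    Laurent n →ₐ[ParamField I] RatFun m :=
  AddMonoidAlgebra.lift (ParamField I) (RatFun m) (VarIdx n →₀ ℤ)
    ((Units.coeHom (RatFun m)).comp
      { toFun := fun k => (Multiplicative.toAdd k).prod fun x d => w x ^ d
        map_one' := by simp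
        map_mul' := fun k l => by
          simpa using Finsupp.prod_add_index' (f := Multiplicative.toAdd k)
            (g := Multiplicative.toAdd l) (h := fun x d => w x ^ d)
            (fun x => zpow_zero (w x)) (fun x d d' => zpow_add (w x) d d') })

/-- Renaming the variables of a rational function along an injective map. -/
noncomputable def ratRename {n m : I → ℕ} (f : VarIdx n ↪ VarIdx m) :
    RatFun n →ₐ[ParamField I] RatFun m :=
  IsFractionRing.liftAlgHom
    (A := MvPolynomial (VarIdx n) (ParamField I))
    (g := (IsScalarTower.toAlgHom (ParamField I) (MvPolynomial (VarIdx m) (ParamField I))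
        (RatFun m)).comp (MvPolynomial.rename f))
    (by
      intro x y h
      exact MvPolynomial.rename_injective f f.injective (IsFractionRing.injective _ _ h))

/-- The action of `∏ i, S_{n_i}` on the index set of the variables. -/
def permIdx {n : I → ℕ} (σ : ∀ i, Equiv.Perm (Fin (n i))) : VarIdx n ≃ VarIdx n :=
  Equiv.sigmaCongrRight σ

/-- The first `n_i` of the variables `z_{i1}, …, z_{i,n_i+m_i}`, for all `i`. -/
def idxLeft (n m : I → ℕ) : VarIdx n ↪ VarIdx (n + m) where
  toFun x := ⟨x.1, Fin.castAdd (m x.1) x.2⟩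
  inj' := by
    rintro ⟨i, a⟩ ⟨j, b⟩ h
    obtain ⟨rfl, h⟩ := Sigma.mk.inj_iff.1 h
    simpa using h

/-- The last `m_i` of the variables `z_{i1}, …, z_{i,n_i+m_i}`, for all `i`. -/
def idxRight (n m : I → ℕ) : VarIdx m ↪ VarIdx (n + m) where
  toFun x := ⟨x.1, Fin.natAdd (n x.1) x.2⟩
  inj' := by
    rintro ⟨i, a⟩ ⟨j, b⟩ h
    obtain ⟨rfl, h⟩ := Sigma.mk.inj_iff.1 h
    simpa using h

end Functions

section Product

variable {I : Type u} [Quiver.{v} I] [Fintype I] [DecidableEq I] [∀ i j : I, Fintype (i ⟶ j)]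

/-- The twisted function `ζ'_{ij}(x)`. -/
noncomputable def zeta' {K : Type*} [Field K] [Algebra (ParamField I) K] (i j : I) (x : K) : K :=
  (if i = j then (1 - x * (algebraMap (ParamField I) K (q I))⁻¹) / (1 - x) else 1) *
    (∏ e : i ⟶ j, (1 / algebraMap (ParamField I) K (t e) - x)) *
    ∏ e : j ⟶ i, (1 - algebraMap (ParamField I) K (t e) / (algebraMap (ParamField I) K (q I) * x))

/-- Symmetrization: the sum over all permutations of `z_{i1}, …, z_{in_i}`, for each `i`
separately. -/
noncomputable def symmetrize (n : I → ℕ) : RatFun n →ₗ[ParamField I] RatFun n :=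
  ∑ σ : ∀ i, Equiv.Perm (Fin (n i)), (ratRename (permIdx σ).toEmbedding).toLinearMap

/-- The shuffle product of a rational function of degree `n` and one of degree `m`, built from the
functions `ζ'_{ij}`. -/
noncomputable def shuffleMul {n m : I → ℕ} (R : RatFun n) (R' : RatFun m) : RatFun (n + m) :=
  symmetrize (n + m)
    (((∏ i, ((n i).factorial : ParamField I)) * ∏ i, ((m i).factorial : ParamField I))⁻¹ •
      (ratRename (idxLeft n m) R * ratRename (idxRight n m) R' *
        ∏ x : VarIdx n, ∏ y : VarIdx m,
          zeta' x.1 y.1 ((z (idxLeft n m x) : RatFun (n + m)) / z (idxRight n m y))))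

/-- The shuffle product, extended bilinearly, makes `⨁ n, RatFun n` a (not necessarily associative
or unital) `𝔽`-algebra. On the subspace of symmetric rational functions, which contains all
the objects considered below, it is the usual associative shuffle product with unit `1` in
degree zero. -/
noncomputable instance :
    DirectSum.GNonUnitalNonAssocSemiring (fun n : I → ℕ => RatFun n) where
  mul := shuffleMul
  mul_zero _ := by simp [shuffleMul]
  zero_mul _ := by simp [shuffleMul]
  mul_add _ _ _ := by simp [shuffleMul, mul_add, add_mul]
  add_mul _ _ _ := by simp [shuffleMul, add_mul]

variable (I) in
/-- The direct sum over all degrees `n ∈ ℕ^I` of the spaces of rational functions, with the twisted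
shuffle product as its multiplication. -/
abbrev Ambient : Type (max u v) := ⨁ n : I → ℕ, RatFun n

theorem shuffleMul_smul_left {n m : I → ℕ} (c : ParamField I) (R : RatFun n) (R' : RatFun m) :
    shuffleMul (c • R) R' = c • shuffleMul R R' := by
  simp only [shuffleMul, map_smul, smul_mul_assoc]
  rw [smul_comm]

theorem shuffleMul_smul_right {n m : I → ℕ} (c : ParamField I) (R : RatFun n) (R' : RatFun m) :
    shuffleMul R (c • R') = c • shuffleMul R R' := by
  simp only [shuffleMul, map_smul, smul_mul_assoc, mul_smul_comm]
  rw [smul_comm]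

theorem lof_mul_lof {n m : I → ℕ} (R : RatFun n) (R' : RatFun m) :
    (DirectSum.lof (ParamField I) (I → ℕ) (fun n => RatFun n) n R : Ambient I) *
        DirectSum.lof (ParamField I) (I → ℕ) (fun n => RatFun n) m R' =
      DirectSum.lof (ParamField I) (I → ℕ) (fun n => RatFun n) (n + m) (shuffleMul R R') :=
  DirectSum.of_mul_of (A := fun n : I → ℕ => RatFun n) R R'

instance : IsScalarTower (ParamField I) (Ambient I) (Ambient I) where
  smul_assoc c x y := by
    simp only [smul_eq_mul]
    induction x using DirectSum.induction_on with
    | zero => simp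
    | add x x' hx hx' => rw [smul_add, add_mul, add_mul, hx, hx', smul_add]
    | of n R =>
      induction y using DirectSum.induction_on with
      | zero => simp
      | add y y' hy hy' => rw [mul_add, mul_add, hy, hy', smul_add]
      | of m R' =>
        simp only [← DirectSum.lof_eq_of (ParamField I), ← map_smul, lof_mul_lof,
          shuffleMul_smul_left]

instance : SMulCommClass (ParamField I) (Ambient I) (Ambient I) where
  smul_comm c x y := by
    simp only [smul_eq_mul]
    induction x using DirectSum.induction_on with
    | zero => simp
    | add x x' hx hx' => rw [add_mul, add_mul, smul_add, hx, hx']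
    | of n R =>
      induction y using DirectSum.induction_on with
      | zero => simp
      | add y y' hy hy' => rw [smul_add, mul_add, mul_add, smul_add, hy, hy']
      | of m R' =>
        simp only [← DirectSum.lof_eq_of (ParamField I), ← map_smul, lof_mul_lof,
          shuffleMul_smul_right]

end Product

section ShuffleAlgebra

variable {I : Type u} [Quiver.{v} I]

/-- The restriction `R|_{z_x = q z_w, z_y = c z_w}` for three distinct variables, the other
variables being kept. -/
noncomputable def restrict [DecidableEq I] {n : I → ℕ} (x y w : VarIdx n) (c : (ParamField I)ˣ) :
    Laurent n →ₐ[ParamField I] RatFun n :=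
  subst fun v =>
    if v = x then scal n (q I) * z w else if v = y then scal n c * z w else z v

/-- `R` is symmetric in `z_{i1}, …, z_{in_i}`, for each `i` separately. -/
def IsSymm {n : I → ℕ} (R : Laurent n) : Prop :=
  ∀ σ : ∀ i, Equiv.Perm (Fin (n i)), subst (fun x => z (permIdx σ x)) R = subst z R

/-- The wheel conditions: for every edge `e : i ⟶ j`,
`R|_{z_{ia} = q z_{jb} / t_e = q z_{ic}} = 0` and `R|_{z_{ja} = t_e z_{ib} = q z_{jc}} = 0`,
where `a ≠ c`, and moreover `a ≠ b ≠ c` if `i = j` (that is, the three variables are distinct).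
The first restriction is `z_{jb} = t_e z_{ic}`, `z_{ia} = q z_{ic}`, and the second one is
`z_{ib} = (q / t_e) z_{jc}`, `z_{ja} = q z_{jc}`. -/
def Wheel [DecidableEq I] {n : I → ℕ} (R : Laurent n) : Prop :=
  ∀ (i j : I) (e : i ⟶ j),
    (∀ (a c : Fin (n i)) (b : Fin (n j)), a ≠ c →
      (⟨i, a⟩ : VarIdx n) ≠ ⟨j, b⟩ → (⟨j, b⟩ : VarIdx n) ≠ ⟨i, c⟩ →
      restrict ⟨i, a⟩ ⟨j, b⟩ ⟨i, c⟩ (t e) R = 0) ∧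
    (∀ (a c : Fin (n j)) (b : Fin (n i)), a ≠ c →
      (⟨j, a⟩ : VarIdx n) ≠ ⟨i, b⟩ → (⟨i, b⟩ : VarIdx n) ≠ ⟨j, c⟩ →
      restrict ⟨j, a⟩ ⟨i, b⟩ ⟨j, c⟩ (q I / t e) R = 0)

/-- The degree `n` part of the shuffle algebra: symmetric Laurent polynomials that satisfy the
wheel conditions. -/
def shuffleSpace [DecidableEq I] (n : I → ℕ) : Submodule (ParamField I) (Laurent n) where
  carrier := {R | IsSymm R ∧ Wheel R}
  zero_mem' := ⟨fun _ => by simp, fun _ _ _ =>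
    ⟨fun _ _ _ _ _ _ => map_zero _, fun _ _ _ _ _ _ => map_zero _⟩⟩
  add_mem' := by
    rintro R R' ⟨h, w⟩ ⟨h', w'⟩
    refine ⟨fun σ => by rw [map_add, map_add, h σ, h' σ], fun i j e => ⟨?_, ?_⟩⟩
    · intro a c b h1 h2 h3
      rw [map_add, (w i j e).1 a c b h1 h2 h3, (w' i j e).1 a c b h1 h2 h3, add_zero]
    · intro a c b h1 h2 h3
      rw [map_add, (w i j e).2 a c b h1 h2 h3, (w' i j e).2 a c b h1 h2 h3, add_zero]
  smul_mem' := by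
    rintro r R ⟨h, w⟩
    refine ⟨fun σ => by rw [map_smul, map_smul, h σ], fun i j e => ⟨?_, ?_⟩⟩
    · intro a c b h1 h2 h3
      rw [map_smul, (w i j e).1 a c b h1 h2 h3, smul_zero]
    · intro a c b h1 h2 h3
      rw [map_smul, (w i j e).2 a c b h1 h2 h3, smul_zero]

variable [Fintype I] [DecidableEq I]

variable (I) in
/-- The underlying vector space of `𝒮'` (and of `𝒮`): the direct sum over `n ∈ ℕ^I` of the degree
`n` parts, Laurent polynomials being regarded as rational functions. -/
noncomputable def shuffleAlgebra : Submodule (ParamField I) (Ambient I) where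
  carrier := {x | ∀ n, ∃ R ∈ shuffleSpace n, subst z R = x n}
  zero_mem' := fun n => ⟨0, zero_mem _, by simp⟩
  add_mem' := by
    intro x y hx hy n
    obtain ⟨R, hR, h⟩ := hx n
    obtain ⟨R', hR', h'⟩ := hy n
    exact ⟨R + R', add_mem hR hR', by rw [map_add, h, h', DirectSum.add_apply]⟩
  smul_mem' := by
    intro c x hx n
    obtain ⟨R, hR, h⟩ := hx n
    exact ⟨c • R, Submodule.smul_mem _ c hR, by rw [map_smul, h, DirectSum.smul_apply]⟩

/-- The element `e_{i,d} = z_{i1}^d` of degree `ς_i = (0, …, 0, 1, 0, …, 0)`. -/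
noncomputable def gen (i : I) (d : ℤ) : Ambient I :=
  DirectSum.lof (ParamField I) (I → ℕ) (fun n => RatFun n) (Pi.single i 1)
    (z ⟨i, ⟨0, by simp⟩⟩ ^ d : (RatFun (Pi.single i 1 : I → ℕ))ˣ)

variable (I) in
/-- The unit `1` of the shuffle algebra, in degree zero. -/
noncomputable def unit : Ambient I :=
  DirectSum.lof (ParamField I) (I → ℕ) (fun n => RatFun n) 0 1

variable (I) in
/-- The (unital) subalgebra generated by the elements `e_{i,d}` with respect to the twisted shuffle
product: the smallest subspace that contains `1` and all `e_{i,d}` and is closed under the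
product. -/
noncomputable def sphericalSubalgebra [∀ i j : I, Fintype (i ⟶ j)] :
    NonUnitalSubalgebra (ParamField I) (Ambient I) :=
  NonUnitalAlgebra.adjoin (ParamField I)
    (insert (unit I) (Set.range fun p : I × ℤ => gen p.1 p.2))

end ShuffleAlgebra

end QuiverShuffle

set_option linter.unusedSectionVars false

/-! Both sides are compared degree by degree with `wordSpace`, the span of all Sym(f · ∏ ζ'), where
f is a Laurent polynomial and the product runs over the pairs of a linear ordering l of the
variables. For a monomial f this is a product of generators taken in the order l
(`lof_symmetrize_mem_spherical`), and word spaces are closed under the shuffle product.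
Multiplication by the Vandermonde product V of the colors turns ∏ ζ' into a Laurent unit times P_l =
`listPenalty`, the product over all y before x of the factors x - u y with u = t_e or q / t_e, and
of x - y / q if the colors agree.

Words satisfy the wheel conditions (`exists_subst_eq_symmetrize`): a wheel is a cyclic chain of
three relations, and every linear ordering of its variables contains the factor of one of them. V
does not vanish on wheels, so dividing by it is harmless, and it does divide the numerator, which is
antisymmetric.

Conversely, let G be a polynomial satisfying the wheel conditions. It is enough that a monomial
multiple of G V lies in the ideal generated by all P_l (`exists_pow_mul_mem_orderIdeal`): dividing
by V and symmetrizing recovers a nonzero multiple of a symmetric G. This is checked in the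
localization at each prime p containing no variable, where only the factors of P_l lying in p
matter. Each such factor is a congruence x ≡ u y. Setting q = 4, t_e = 2 gives every such u a weight
(1 for edges, -2 for q⁻¹), and weights exclude cycles of edge congruences.

The local claim is an induction on the number of variables (`mul_vandermonde_mem_saturation_aux`).
Remove a variable x of lowest weight. More generally suppose that G vanishes on all edge relations
of x that hold modulo p, and divide by their product. Then divide by the product of all x - y / q in
p. The quotient is handled by placing x last. The remainder is a Lagrange interpolant with terms G
restricted to x = x' / q. The wheel conditions make such a term vanish on the edge relations of x',
so induction applies with x' in the role of x, and x is inserted just before the q-string of x'. The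
Lagrange denominators are differences of variables of one color, and V supplies them. -/

namespace QuiverShuffle

/-! ### Weights of scalars, and the edge parameters t_e and q / t_e. -/

section Weights

variable {I : Type u} [Quiver.{v} I]

variable (I) in
/-- The specialization `q ↦ 4`, `t_e ↦ 2` of the parameters. -/
noncomputable def specialize : MvPolynomial (Option (Quiver.Total I)) ℚ →ₐ[ℚ] ℚ :=
  MvPolynomial.aeval fun o => o.elim 4 fun _ => 2

/-- The scalar `u` specializes to `2 ^ k` under `q ↦ 4`, `t_e ↦ 2`. -/
def HasWeight (u : (ParamField I)ˣ) (k : ℤ) : Prop :=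
  ∃ a b : MvPolynomial (Option (Quiver.Total I)) ℚ, specialize I b ≠ 0 ∧
    algebraMap _ (ParamField I) a = u * algebraMap _ (ParamField I) b ∧
    specialize I a = 2 ^ k * specialize I b

/-- A scalar with a weight is a fraction whose denominator survives the specialization.
Cross-multiplying two presentations gives equal values, and distinct powers of 2 differ. -/
theorem HasWeight.unique {u : (ParamField I)ˣ} {k l : ℤ} (h : HasWeight u k)
    (h' : HasWeight u l) : k = l := by
  obtain ⟨a, b, hb, hab, e⟩ := h
  obtain ⟨a', b', hb', hab', e'⟩ := h'
  have h1 : a * b' = a' * b := by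
    apply IsFractionRing.injective (MvPolynomial (Option (Quiver.Total I)) ℚ) (ParamField I)
    rw [map_mul, map_mul, hab, hab']
    ring
  have h2 := congrArg (specialize I) h1
  rw [map_mul, map_mul, e, e'] at h2
  have h3 : (2 : ℚ) ^ k = 2 ^ l := by
    have h4 : specialize I b * specialize I b' ≠ 0 := mul_ne_zero hb hb'
    apply mul_right_cancel₀ h4
    linear_combination h2
  exact zpow_right_injective₀ (by norm_num) (by norm_num) h3

theorem HasWeight.mul {u u' : (ParamField I)ˣ} {k l : ℤ} (h : HasWeight u k)
    (h' : HasWeight u' l) : HasWeight (u * u') (k + l) := by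
  obtain ⟨a, b, hb, hab, e⟩ := h
  obtain ⟨a', b', hb', hab', e'⟩ := h'
  refine ⟨a * a', b * b', by rw [map_mul]; exact mul_ne_zero hb hb', ?_, ?_⟩
  · rw [map_mul, map_mul, hab, hab', Units.val_mul]
    ring
  · rw [map_mul, map_mul, e, e', zpow_add₀ (by norm_num)]
    ring

theorem HasWeight.inv {u : (ParamField I)ˣ} {k : ℤ} (h : HasWeight u k) :
    HasWeight u⁻¹ (-k) := by
  obtain ⟨a, b, hb, hab, e⟩ := h
  refine ⟨b, a, ?_, ?_, ?_⟩
  · rw [e]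
    exact mul_ne_zero (by positivity) hb
  · rw [hab, Units.inv_mul_cancel_left]
  · rw [e, ← mul_assoc, ← zpow_add₀ (by norm_num)]
    simp

theorem hasWeight_one : HasWeight (1 : (ParamField I)ˣ) 0 :=
  ⟨1, 1, by simp, by simp, by simp⟩

theorem HasWeight.pow {u : (ParamField I)ˣ} {k : ℤ} (h : HasWeight u k) (m : ℕ) :
    HasWeight (u ^ m) (m * k) := by
  induction m with
  | zero => simpa using hasWeight_one
  | succ m ih =>
    rw [pow_succ]
    convert ih.mul h using 1
    push_cast
    ring

theorem hasWeight_q : HasWeight (q I) 2 :=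
  ⟨MvPolynomial.X none, 1, by simp, by simp [q], by simp [specialize]; norm_num⟩

theorem hasWeight_t {i j : I} (e : i ⟶ j) : HasWeight (t e) 1 :=
  ⟨MvPolynomial.X (some ⟨i, j, e⟩), 1, by simp, by simp [t], by simp [specialize]⟩

/-- The edges between `i` and `j`, in both directions. -/
abbrev EdgeBetween (i j : I) : Type v := (i ⟶ j) ⊕ (j ⟶ i)

/-- The parameter `t_e` of an edge `e : i ⟶ j`, respectively `q / t_e` of an edge `e : j ⟶ i`. -/
noncomputable def ratio {i j : I} : EdgeBetween i j → (ParamField I)ˣ :=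
  Sum.elim (fun e => t e) fun e => q I / t e

theorem hasWeight_ratio {i j : I} (e : EdgeBetween i j) : HasWeight (ratio e) 1 := by
  rcases e with e | e
  · exact hasWeight_t e
  · simpa [ratio, div_eq_mul_inv] using hasWeight_q.mul (hasWeight_t e).inv

theorem ratio_swap {i j : I} (e : EdgeBetween i j) : ratio e.swap = q I / ratio e := by
  rcases e with e | e <;> simp [ratio]

theorem t_injective {i j : I} : Function.Injective (fun e : i ⟶ j => t e) := by
  intro e f h
  have h1 := congrArg (fun u : (ParamField I)ˣ => (u : ParamField I)) h
  have h2 := MvPolynomial.X_injective (IsFractionRing.injective _ _ h1)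
  simpa using h2

theorem t_mul_t_ne_q {i j k l : I} (e : i ⟶ j) (f : k ⟶ l) : t e * t f ≠ q I := by
  intro h
  have h1 := congrArg (fun u : (ParamField I)ˣ => (u : ParamField I)) h
  have h2 : (MvPolynomial.X (some ⟨i, j, e⟩) * MvPolynomial.X (some ⟨k, l, f⟩) :
      MvPolynomial (Option (Quiver.Total I)) ℚ) = MvPolynomial.X none := by
    apply IsFractionRing.injective (MvPolynomial (Option (Quiver.Total I)) ℚ) (ParamField I)
    rw [map_mul]
    exact h1
  -- Weights do not separate the two sides, since 2 · 2 = 4; hence the value 1 for the t's.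
  have h3 := congrArg (MvPolynomial.eval fun o => o.elim (4 : ℚ) fun _ => 1) h2
  simp at h3

/-- Ensures that the edge factors between two variables are distinct, so that vanishing at each of
them gives divisibility by their product. -/
theorem ratio_injective {i j : I} : Function.Injective (ratio : EdgeBetween i j → _) := by
  rintro (e | e) (f | f) h
  · rw [t_injective h]
  · exact absurd (eq_div_iff_mul_eq'.1 h) (t_mul_t_ne_q e f)
  · exact absurd (eq_div_iff_mul_eq'.1 h.symm) (t_mul_t_ne_q f e)
  · rw [t_injective (div_right_injective h)]

end Weights

/-! ### Division and Lagrange interpolation in one variable. -/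

section Substitution

variable {K X : Type*} [Field K] [DecidableEq X]

/-- Substitution of `a` for the variable `x`. -/
noncomputable def replace (x : X) (a : MvPolynomial X K) :
    MvPolynomial X K →ₐ[K] MvPolynomial X K :=
  MvPolynomial.aeval (Function.update MvPolynomial.X x a)

@[simp] theorem replace_X_self (x : X) (a : MvPolynomial X K) :
    replace x a (MvPolynomial.X x) = a := by
  simp [replace]

theorem replace_X_of_ne {x y : X} (h : y ≠ x) (a : MvPolynomial X K) :
    replace x a (MvPolynomial.X y) = MvPolynomial.X y := by
  simp [replace, h]

/-- A polynomial, regarded as a polynomial in the single variable `x`. -/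
noncomputable def isolate (x : X) :
    MvPolynomial X K →ₐ[K] Polynomial (MvPolynomial X K) :=
  MvPolynomial.aeval (Function.update (fun y => Polynomial.C (MvPolynomial.X y)) x Polynomial.X)

@[simp] theorem isolate_X_self (x : X) :
    isolate x (MvPolynomial.X x : MvPolynomial X K) = Polynomial.X := by
  simp [isolate]

theorem isolate_X_of_ne {x y : X} (h : y ≠ x) :
    isolate x (MvPolynomial.X y : MvPolynomial X K) = Polynomial.C (MvPolynomial.X y) := by
  simp [isolate, h]

theorem isolate_C (x : X) (k : K) :
    isolate x (MvPolynomial.C k : MvPolynomial X K) = Polynomial.C (MvPolynomial.C k) := by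
  rw [← MvPolynomial.algebraMap_eq, AlgHom.commutes]
  rfl

theorem isolate_C_mul_X {x y : X} (h : y ≠ x) (k : K) :
    isolate x (MvPolynomial.C k * MvPolynomial.X y : MvPolynomial X K) =
      Polynomial.C (MvPolynomial.C k * MvPolynomial.X y) := by
  rw [map_mul, isolate_C, isolate_X_of_ne h, map_mul]

theorem eval_isolate (x : X) (a G : MvPolynomial X K) :
    (isolate x G).eval a = replace x a G := by
  have h : (Polynomial.evalRingHom a).comp (isolate (K := K) x : MvPolynomial X K →+* _) =
      (replace x a : MvPolynomial X K →+* _) := by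
    apply MvPolynomial.ringHom_ext
    · intro k
      simp only [RingHom.comp_apply, RingHom.coe_coe, isolate_C]
      simp only [Polynomial.coe_evalRingHom, Polynomial.eval_C]
      exact ((replace x a).commutes k).symm
    · intro y
      by_cases hy : y = x
      · subst hy
        simp
      · simp [isolate_X_of_ne hy, replace_X_of_ne hy]
  exact RingHom.congr_fun h G

theorem replace_X_eq (x : X) (G : MvPolynomial X K) : replace x (MvPolynomial.X x) G = G := by
  simp [replace]

/-- Such a ψ acts only on the coefficients of a polynomial in x, and therefore commutes with
division by monic polynomials in x. -/
theorem isolate_map_of_fixes (x : X) (ψ : MvPolynomial X K →ₐ[K] MvPolynomial X K)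
    (hx : ψ (MvPolynomial.X x) = MvPolynomial.X x)
    (h : ∀ y, y ≠ x → isolate x (ψ (MvPolynomial.X y)) = Polynomial.C (ψ (MvPolynomial.X y)))
    (G : MvPolynomial X K) :
    isolate x (ψ G) = (isolate x G).map (ψ : MvPolynomial X K →+* MvPolynomial X K) := by
  have h : (isolate (K := K) x : MvPolynomial X K →+* _).comp
        (ψ : MvPolynomial X K →+* MvPolynomial X K) =
      (Polynomial.mapRingHom (ψ : MvPolynomial X K →+* MvPolynomial X K)).comp
        (isolate (K := K) x : MvPolynomial X K →+* _) := by
    apply MvPolynomial.ringHom_ext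
    · intro k
      have := ψ.commutes k
      simp only [MvPolynomial.algebraMap_eq] at this
      simp [this]
    · intro y
      by_cases hy : y = x
      · subst hy
        simp [hx]
      · simp [isolate_X_of_ne hy, h y hy]
  exact RingHom.congr_fun h G

theorem prod_X_sub_dvd {ι : Type*} (x : X) (S : Finset ι) (a : ι → MvPolynomial X K)
    (ha : Set.InjOn a S) (G : MvPolynomial X K) (h : ∀ i ∈ S, replace x (a i) G = 0) :
    ∏ i ∈ S, (MvPolynomial.X x - a i) ∣ G := by
  classical
  by_cases hG : isolate x G = 0
  · rw [← replace_X_eq x G, ← eval_isolate, hG]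
    simp
  have h1 : ((S.val.map a).map fun r => Polynomial.X - Polynomial.C r).prod ∣ isolate x G := by
    rw [Multiset.prod_X_sub_C_dvd_iff_le_roots hG]
    refine (Multiset.le_iff_subset ?_).2 ?_
    · exact Multiset.Nodup.map_on (fun i hi j hj e => ha hi hj e) S.nodup
    · intro r hr
      obtain ⟨i, hi, rfl⟩ := Multiset.mem_map.1 hr
      rw [Polynomial.mem_roots hG, Polynomial.IsRoot.def, eval_isolate]
      exact h i hi
  have h2 := map_dvd (Polynomial.evalRingHom (MvPolynomial.X x)) h1
  simp only [Polynomial.coe_evalRingHom] at h2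
  rw [eval_isolate, replace_X_eq, Multiset.map_map] at h2
  refine dvd_trans (dvd_of_eq ?_) h2
  change _ = Polynomial.eval _ (∏ i ∈ S, (Polynomial.X - Polynomial.C (a i)))
  rw [Polynomial.eval_prod]
  simp

/-- Division by `∏ i, (x - a i)`: the quotient `g` inherits the vanishing of `G` under
substitutions not involving `x`, and the remainder is the Lagrange interpolant. -/
theorem exists_interpolation {ι : Type*} [DecidableEq ι] (x : X) (S : Finset ι)
    (a : ι → MvPolynomial X K) (ha : Set.InjOn a S) (G : MvPolynomial X K) :
    ∃ g : MvPolynomial X K,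
      (∀ ψ : MvPolynomial X K →ₐ[K] MvPolynomial X K, ψ (MvPolynomial.X x) = MvPolynomial.X x →
        (∀ y, y ≠ x → isolate x (ψ (MvPolynomial.X y)) = Polynomial.C (ψ (MvPolynomial.X y))) →
        ψ G = 0 → ψ g = 0) ∧
      ∀ (D : MvPolynomial X K) (D' : ι → MvPolynomial X K),
        (∀ i ∈ S, D = (∏ j ∈ S.erase i, (a i - a j)) * D' i) →
        D * G = D * ((∏ i ∈ S, (MvPolynomial.X x - a i)) * g) +
          ∑ i ∈ S, D' i * (replace x (a i) G * ∏ j ∈ S.erase i, (MvPolynomial.X x - a j)) := by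
  set U : Polynomial (MvPolynomial X K) := ∏ i ∈ S, (Polynomial.X - Polynomial.C (a i)) with hU
  have hm : U.Monic := Polynomial.monic_prod_of_monic _ _ fun i _ => Polynomial.monic_X_sub_C _
  have hdegU : U.degree = S.card := by
    rw [hU, Polynomial.degree_prod]
    simp
  refine ⟨(isolate x G /ₘ U).eval (MvPolynomial.X x), ?_, ?_⟩
  · intro ψ hx hy hG
    have h0 : (isolate x G).map (ψ : MvPolynomial X K →+* MvPolynomial X K) = 0 := by
      rw [← isolate_map_of_fixes x ψ hx hy, hG, map_zero]
    have h1 : (isolate x G /ₘ U).map (ψ : MvPolynomial X K →+* MvPolynomial X K) = 0 := by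
      rw [Polynomial.map_divByMonic _ hm, h0, Polynomial.zero_divByMonic]
    have h2 := Polynomial.eval_map_apply (f := (ψ : MvPolynomial X K →+* MvPolynomial X K))
      (p := isolate x G /ₘ U) (x := MvPolynomial.X x)
    rw [h1] at h2
    simpa [hx] using h2.symm
  · intro D D' hD
    set r := isolate x G %ₘ U with hr
    have hdiv : r + U * (isolate x G /ₘ U) = isolate x G := Polynomial.modByMonic_add_div _ U
    have hUa : ∀ i ∈ S, U.eval (a i) = 0 := by
      intro i hi
      rw [hU, Polynomial.eval_prod]
      exact Finset.prod_eq_zero hi (by simp)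
    have hra : ∀ i ∈ S, r.eval (a i) = replace x (a i) G := by
      intro i hi
      rw [← eval_isolate, ← hdiv]
      simp [hUa i hi]
    -- Both sides have degree less than |S| in x and agree at the |S| distinct points a i. The
    -- factor D clears the Lagrange denominators.
    have key : Polynomial.C D * r = ∑ i ∈ S, Polynomial.C (D' i * replace x (a i) G) *
        ∏ j ∈ S.erase i, (Polynomial.X - Polynomial.C (a j)) := by
      rcases S.eq_empty_or_nonempty with rfl | hS
      · have : U = 1 := by simp [hU]
        simp [hr, this]
      refine Polynomial.eq_of_degrees_lt_of_eval_index_eq S ha ?_ ?_ ?_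
      · have := Polynomial.degree_modByMonic_lt (isolate x G) hm
        rw [hdegU] at this
        refine lt_of_le_of_lt ?_ this
        refine (Polynomial.degree_mul_le _ _).trans ?_
        calc _ ≤ 0 + r.degree := by gcongr; exact Polynomial.degree_C_le
          _ = _ := by rw [zero_add]
      · refine lt_of_le_of_lt (Polynomial.degree_sum_le _ _) ?_
        rw [Finset.sup_lt_iff (by simp)]
        intro i hi
        refine lt_of_le_of_lt (Polynomial.degree_mul_le _ _) ?_
        rw [Polynomial.degree_prod]
        simp only [Polynomial.degree_X_sub_C, Finset.sum_const, Finset.card_erase_of_mem hi]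
        have hc : 0 < S.card := Finset.card_pos.2 hS
        calc _ ≤ 0 + (S.card - 1) • (1 : WithBot ℕ) := by gcongr; exact Polynomial.degree_C_le
          _ < _ := by
            rw [zero_add, nsmul_one]
            exact_mod_cast Nat.sub_lt hc one_pos
      · intro i hi
        rw [Polynomial.eval_mul, Polynomial.eval_C, hra i hi, Polynomial.eval_finsetSum,
          Finset.sum_eq_single i]
        · rw [hD i hi]
          simp only [Polynomial.eval_mul, Polynomial.eval_C, Polynomial.eval_prod,
            Polynomial.eval_sub, Polynomial.eval_X]
          ring
        · intro j hj hji
          rw [Polynomial.eval_mul, Polynomial.eval_prod,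
            Finset.prod_eq_zero (Finset.mem_erase.2 ⟨hji.symm, hi⟩) (by simp), mul_zero]
        · exact fun h => absurd hi h
    have h3 := congrArg (Polynomial.eval (MvPolynomial.X x)) key
    have h4 := congrArg (Polynomial.eval (MvPolynomial.X x)) hdiv
    rw [eval_isolate, replace_X_eq] at h4
    have h5 : U.eval (MvPolynomial.X x) = ∏ i ∈ S, (MvPolynomial.X x - a i) := by
      rw [hU, Polynomial.eval_prod]
      simp
    rw [Polynomial.eval_mul, Polynomial.eval_C, Polynomial.eval_finsetSum] at h3
    rw [Polynomial.eval_add, Polynomial.eval_mul, h5] at h4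
    calc D * G = D * ((∏ i ∈ S, (MvPolynomial.X x - a i)) *
            (isolate x G /ₘ U).eval (MvPolynomial.X x)) + D * r.eval (MvPolynomial.X x) := by
          linear_combination -D * h4
      _ = _ := by
          rw [h3]
          congr 1
          refine Finset.sum_congr rfl fun i _ => ?_
          simp only [Polynomial.eval_mul, Polynomial.eval_C, Polynomial.eval_prod,
            Polynomial.eval_sub, Polynomial.eval_X]
          ring

theorem C_mul_X_injective {x y : X} {k l : K} (hk : k ≠ 0)
    (h : (MvPolynomial.C k * MvPolynomial.X x : MvPolynomial X K) =
      MvPolynomial.C l * MvPolynomial.X y) : x = y ∧ k = l := by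
  have hxy : x = y := by
    by_contra hne
    have := congrArg (MvPolynomial.eval (Function.update 0 x 1)) h
    simp [Function.update_of_ne (Ne.symm hne)] at this
    exact hk this
  subst hxy
  refine ⟨rfl, ?_⟩
  have := congrArg (MvPolynomial.eval fun _ => (1 : K)) h
  simpa using this

end Substitution

/-! ### Ideal membership after localization at a prime. -/

section Saturation

variable {A : Type*} [CommRing A]

/-- The elements that lie in the ideal `J` after localization at the prime ideal `p`. -/
def saturation (p : Ideal A) [p.IsPrime] (J : Ideal A) : Ideal A where
  carrier := {F | ∃ f, f ∉ p ∧ f * F ∈ J}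
  zero_mem' := ⟨1, p.one_notMem, by simp⟩
  add_mem' := by
    rintro F F' ⟨f, hf, h⟩ ⟨f', hf', h'⟩
    refine ⟨f * f', p.primeCompl.mul_mem hf hf', ?_⟩
    have e : f * f' * (F + F') = f' * (f * F) + f * (f' * F') := by ring
    rw [e]
    exact J.add_mem (J.mul_mem_left _ h) (J.mul_mem_left _ h')
  smul_mem' := by
    rintro a F ⟨f, hf, h⟩
    refine ⟨f, hf, ?_⟩
    rw [smul_eq_mul, mul_left_comm]
    exact J.mul_mem_left _ h

variable {p : Ideal A} [p.IsPrime]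

theorem le_saturation (J : Ideal A) : J ≤ saturation p J :=
  fun F hF => ⟨1, p.one_notMem, by simpa using hF⟩

theorem mem_saturation_of_mul_mem {J : Ideal A} {u F : A} (hu : u ∉ p)
    (h : u * F ∈ saturation p J) : F ∈ saturation p J := by
  obtain ⟨f, hf, h⟩ := h
  exact ⟨f * u, p.primeCompl.mul_mem hf hu, by rwa [mul_assoc]⟩

/-- Local containment may be tested on generators. This transports orderings of s to orderings of s
with one more variable. -/
theorem mul_mem_saturation_of_span {S : Set A} {J : Ideal A} {m F : A}
    (h : ∀ P ∈ S, m * P ∈ saturation p J) (hF : F ∈ saturation p (Ideal.span S)) :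
    m * F ∈ saturation p J := by
  obtain ⟨f, hf, h1⟩ := hF
  apply mem_saturation_of_mul_mem hf
  rw [mul_left_comm]
  generalize f * F = F' at h1 ⊢
  induction h1 using Submodule.span_induction with
  | mem x hx => exact h x hx
  | zero => simp
  | add x y _ _ hx hy =>
    rw [mul_add]
    exact add_mem hx hy
  | smul a x _ hx =>
    rw [smul_eq_mul, mul_left_comm]
    exact Ideal.mul_mem_left _ _ hx

theorem list_prod_notMem {l : List A} (h : ∀ a ∈ l, a ∉ p) : l.prod ∉ p :=
  p.primeCompl.list_prod_mem h

theorem finset_prod_notMem {ι : Type*} {s : Finset ι} {f : ι → A} (h : ∀ a ∈ s, f a ∉ p) :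
    ∏ i ∈ s, f i ∉ p :=
  p.primeCompl.prod_mem h

end Saturation

/-! ### Products over orderings, Vandermonde products and wheel substitutions. -/

section Penalty

variable {I : Type u} [Quiver.{v} I] [DecidableEq I] [∀ i j : I, Fintype (i ⟶ j)]
  {X : Type*} [DecidableEq X] (c : X → I)

local notation "𝒜" => MvPolynomial X (ParamField I)

open MvPolynomial (C)

/-- The linear form `x - u y`. -/
noncomputable def linForm (u : (ParamField I)ˣ) (y x : X) : 𝒜 :=
  MvPolynomial.X x - C (u : ParamField I) * MvPolynomial.X y

/-- The numerator of the product of the functions `ζ'` when `y` precedes `x`. -/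
noncomputable def penalty (y x : X) : 𝒜 :=
  (if c y = c x then linForm (q I)⁻¹ y x else 1) *
    ∏ e : EdgeBetween (c y) (c x), linForm (ratio e) y x

/-- The product of `penalty y x` over all pairs `y`, `x` with `y` preceding `x` in the list. -/
noncomputable def listPenalty : List X → 𝒜
  | [] => 1
  | x :: l => listPenalty l * (l.map (penalty c x)).prod

/-- The difference of two variables of the same color. -/
noncomputable def colorDiff (x y : X) : 𝒜 :=
  if c x = c y then MvPolynomial.X y - MvPolynomial.X x else 1

/-- The product of the Vandermonde determinants of the colors. -/
noncomputable def vandermonde : List X → 𝒜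
  | [] => 1
  | x :: l => vandermonde l * (l.map (colorDiff c x)).prod

theorem listPenalty_insert (l τ : List X) (x : X) :
    listPenalty c (l ++ x :: τ) = listPenalty c (l ++ τ) *
      ((l.map fun y => penalty c y x).prod * (τ.map (penalty c x)).prod) := by
  induction l with
  | nil => simp [listPenalty]
  | cons y l ih =>
    simp only [List.cons_append, listPenalty, ih, List.map_append, List.map_cons, List.prod_append,
      List.prod_cons]
    ring

theorem colorDiff_swap (x y : X) : Associated (colorDiff c x y) (colorDiff c y x) := by
  unfold colorDiff
  by_cases h : c x = c y
  · rw [if_pos h, if_pos h.symm, ← neg_sub]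
    exact Associated.neg_left (Associated.refl _)
  · rw [if_neg h, if_neg (Ne.symm h)]

/-- Transposing two neighbors changes at most a sign. -/
theorem vandermonde_perm {l l' : List X} (h : l.Perm l') :
    Associated (vandermonde c l) (vandermonde c l') := by
  induction h with
  | nil => exact Associated.refl _
  | cons x h ih =>
    refine ih.mul_mul ?_
    rw [(h.map _).prod_eq]
    exact Associated.refl _
  | swap x y l =>
    simp only [vandermonde, List.map_cons, List.prod_cons]
    have e : ∀ a b d f : 𝒜, a * b * (d * f) = a * b * f * d := fun a b d f => by ring
    have e' : ∀ a b d f : 𝒜, a * b * (d * f) = a * f * b * d := fun a b d f => by ring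
    rw [e, e']
    exact (Associated.refl _).mul_mul (colorDiff_swap c y x)
  | trans _ _ h1 h2 => exact h1.trans h2

theorem vandermonde_erase (s : Finset X) {x : X} (hx : x ∈ s) :
    Associated (vandermonde c s.toList)
      (vandermonde c (s.erase x).toList * ∏ y ∈ s.erase x, colorDiff c x y) := by
  have h : s.toList.Perm (x :: (s.erase x).toList) := by
    have := Finset.toList_insert (Finset.notMem_erase x s)
    rwa [Finset.insert_erase hx] at this
  have h1 := vandermonde_perm c h
  rwa [vandermonde, Finset.prod_map_toList] at h1

/-- The ideal generated by the products `listPenalty` over all orderings of `s`. -/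
noncomputable def orderIdeal (s : Finset X) : Ideal 𝒜 :=
  Ideal.span {P | ∃ l : List X, l.Nodup ∧ (∀ a, a ∈ l ↔ a ∈ s) ∧ P = listPenalty c l}

/-- The substitution `x = q w`, `y = (q / u) w`. -/
noncomputable def wheelSub (x y w : X) (u : (ParamField I)ˣ) : 𝒜 →ₐ[ParamField I] 𝒜 :=
  MvPolynomial.aeval fun v =>
    if v = x then C (q I : ParamField I) * MvPolynomial.X w
    else if v = y then C ((q I / u : (ParamField I)ˣ) : ParamField I) * MvPolynomial.X w
    else MvPolynomial.X v

/-- The wheel conditions for the variables in `s`. -/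
def WheelOn (s : Finset X) (G : 𝒜) : Prop :=
  ∀ x ∈ s, ∀ y ∈ s, ∀ w ∈ s, x ≠ w → x ≠ y → y ≠ w → c x = c w →
    ∀ e : EdgeBetween (c y) (c x), wheelSub x y w (ratio e) G = 0

theorem wheelSub_X_of_ne {x y w v : X} (hx : v ≠ x) (hy : v ≠ y) (u : (ParamField I)ˣ) :
    wheelSub x y w u (MvPolynomial.X v) = MvPolynomial.X v := by
  simp [wheelSub, hx, hy]

theorem exists_wheelSub_X (x y w : X) (u : (ParamField I)ˣ) (hu : HasWeight u 1) (v : X) :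
    ∃ k : (ParamField I)ˣ,
      wheelSub x y w u (MvPolynomial.X v) =
        C (k : ParamField I) * MvPolynomial.X (if v = x ∨ v = y then w else v) ∧
      HasWeight k (if v = x then 2 else if v = y then 1 else 0) := by
  by_cases h1 : v = x
  · exact ⟨q I, by simp [wheelSub, h1], by simpa [h1] using hasWeight_q⟩
  by_cases h2 : v = y
  · subst h2
    refine ⟨q I / u, by simp [wheelSub, h1], ?_⟩
    simpa [h1, div_eq_mul_inv] using hasWeight_q.mul hu.inv
  · exact ⟨1, by simp [wheelSub, h1, h2], by simpa [h1, h2] using hasWeight_one⟩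

/-- The substitution sends x and y to multiples of w of weights 2 and 1 and fixes the other
variables. The two terms of a linear form can cancel only if they involve the same variable with the
same weight. -/
theorem wheelSub_linForm_ne_zero {x y w a b : X} {u u' : (ParamField I)ˣ} {k : ℤ}
    (hu : HasWeight u 1) (hu' : HasWeight u' k)
    (h : (if a = x ∨ a = y then w else a) = (if b = x ∨ b = y then w else b) →
      (if a = x then (2 : ℤ) else if a = y then 1 else 0) ≠
        k + (if b = x then 2 else if b = y then 1 else 0)) :
    wheelSub x y w u (linForm u' b a) ≠ 0 := by
  obtain ⟨m, hm, hm'⟩ := exists_wheelSub_X x y w u hu a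
  obtain ⟨n, hn, hn'⟩ := exists_wheelSub_X x y w u hu b
  intro h0
  rw [linForm, map_sub, map_mul, hm, hn, ← MvPolynomial.algebraMap_eq, AlgHom.commutes,
    MvPolynomial.algebraMap_eq, ← mul_assoc, ← map_mul, sub_eq_zero, ← Units.val_mul] at h0
  obtain ⟨h1, h2⟩ := C_mul_X_injective m.ne_zero h0
  rw [Units.ext h2] at hm'
  exact h h1 (hm'.unique (hu'.mul hn'))

theorem wheelSub_colorDiff_ne_zero {x y w a b : X} {u : (ParamField I)ˣ}
    (hu : HasWeight u 1) (hxy : x ≠ y) (hab : a ≠ b) :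
    wheelSub x y w u (colorDiff c a b) ≠ 0 := by
  unfold colorDiff
  split_ifs
  · have h := wheelSub_linForm_ne_zero (x := x) (y := y) (w := w) (a := b) (b := a) hu hasWeight_one
      (by split_ifs <;> grind)
    simpa [linForm] using h
  · simp

/-- Distinct variables that become multiples of w carry distinct weights among 2, 1, 0, so no
difference collapses. Hence V can be cancelled from a wheel condition. -/
theorem wheelSub_vandermonde_ne_zero {x y w : X} {u : (ParamField I)ˣ}
    (hu : HasWeight u 1) (hxy : x ≠ y) {l : List X} (hl : l.Nodup) :
    wheelSub x y w u (vandermonde c l) ≠ 0 := by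
  induction l with
  | nil => simp [vandermonde]
  | cons a l ih =>
    rw [List.nodup_cons] at hl
    rw [vandermonde, map_mul, map_list_prod, List.map_map]
    refine mul_ne_zero (ih hl.2) (List.prod_ne_zero ?_)
    rw [List.mem_map]
    rintro ⟨b, hb, h0⟩
    exact wheelSub_colorDiff_ne_zero c hu hxy (by rintro rfl; exact hl.1 hb) h0

/-- Substitutions commute if the second one does not involve the replaced variable. -/
theorem map_replace (ψ : 𝒜 →ₐ[ParamField I] 𝒜) (x : X) (b G : 𝒜)
    (hx : ψ (MvPolynomial.X x) = MvPolynomial.X x)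
    (h : ∀ v, v ≠ x → replace x (ψ b) (ψ (MvPolynomial.X v)) = ψ (MvPolynomial.X v)) :
    ψ (replace x b G) = replace x (ψ b) (ψ G) := by
  have : ψ.comp (replace x b) = (replace x (ψ b)).comp ψ := by
    apply MvPolynomial.algHom_ext
    intro v
    by_cases hv : v = x
    · subst hv
      simp [hx]
    · simp [replace_X_of_ne hv, h v hv]
  exact congrArg (fun f : 𝒜 →ₐ[ParamField I] 𝒜 => f G) this

theorem wheelSub_replace {x x' y w : X} (u : (ParamField I)ˣ) (h1 : x ≠ x') (h2 : x ≠ y)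
    (h3 : x ≠ w) (b G : 𝒜) :
    wheelSub x' y w u (replace x b G) =
      replace x (wheelSub x' y w u b) (wheelSub x' y w u G) := by
  apply map_replace
  · exact wheelSub_X_of_ne h1 h2 u
  · intro v hv
    unfold wheelSub
    simp only [MvPolynomial.aeval_X]
    split_ifs
    · rw [map_mul, replace_X_of_ne h3.symm, ← MvPolynomial.algebraMap_eq, AlgHom.commutes]
    · rw [map_mul, replace_X_of_ne h3.symm, ← MvPolynomial.algebraMap_eq, AlgHom.commutes]
    · exact replace_X_of_ne hv _

theorem isolate_wheelSub {x x' y w : X} (u : (ParamField I)ˣ) (h3 : x ≠ w) (v : X) (hv : v ≠ x) :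
    isolate x (wheelSub x' y w u (MvPolynomial.X v)) =
      Polynomial.C (wheelSub x' y w u (MvPolynomial.X v)) := by
  unfold wheelSub
  simp only [MvPolynomial.aeval_X]
  split_ifs
  · exact isolate_C_mul_X h3.symm _
  · exact isolate_C_mul_X h3.symm _
  · exact isolate_X_of_ne hv

end Penalty

/-! ### Congruences between variables modulo a prime without variables. -/

section Local

variable {I : Type u} [Quiver.{v} I] [DecidableEq I] [∀ i j : I, Fintype (i ⟶ j)]
  {X : Type*} [DecidableEq X] (c : X → I)

local notation "𝒜" => MvPolynomial X (ParamField I)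

open MvPolynomial (C)

variable (p : Ideal (MvPolynomial X (ParamField I))) [p.IsPrime]

open Classical in
/-- The factors `x - y / q` of `penalty y x` that lie in the prime ideal `p`. -/
noncomputable def qPart (y x : X) : 𝒜 :=
  if c y = c x ∧ linForm (q I)⁻¹ y x ∈ p then linForm (q I)⁻¹ y x else 1

open Classical in
/-- The edges whose factors of `penalty y x` lie in the prime ideal `p`. -/
noncomputable def badEdges (y x : X) : Finset (EdgeBetween (c y) (c x)) :=
  Finset.univ.filter fun e => linForm (ratio e) y x ∈ p

/-- The factors of `penalty y x` that come from edges and lie in the prime ideal `p`. -/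
noncomputable def edgePart (y x : X) : 𝒜 :=
  ∏ e ∈ badEdges c p y x, linForm (ratio e) y x

open Classical in
/-- The variables `y` whose factor `x - y / q` of `penalty y x` lies in the prime ideal `p`. -/
noncomputable def stringNext (s : Finset X) (x : X) : Finset X :=
  s.filter fun y => c y = c x ∧ linForm (q I)⁻¹ y x ∈ p

/-- Factors outside p are units after localization, so only `qPart` and `edgePart` matter. -/
theorem exists_penalty_eq (y x : X) :
    ∃ f : 𝒜, f ∉ p ∧ penalty c y x = f * (qPart c p y x * edgePart c p y x) := by
  classical
  have h1 : ∃ f : 𝒜, f ∉ p ∧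
      (if c y = c x then linForm (q I)⁻¹ y x else 1) = f * qPart c p y x := by
    unfold qPart
    by_cases h : c y = c x
    · by_cases h' : linForm (q I)⁻¹ y x ∈ p
      · exact ⟨1, p.one_notMem, by simp [h, h']⟩
      · exact ⟨_, h', by simp [h, h']⟩
    · exact ⟨1, p.one_notMem, by simp [h]⟩
  obtain ⟨f, hf, hf'⟩ := h1
  refine ⟨f * ∏ e ∈ Finset.univ.filter fun e : EdgeBetween (c y) (c x) =>
    ¬ linForm (ratio e) y x ∈ p, linForm (ratio e) y x, ?_, ?_⟩
  · refine p.primeCompl.mul_mem hf (finset_prod_notMem fun e he => ?_)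
    exact (Finset.mem_filter.1 he).2
  · rw [penalty, hf', edgePart, badEdges,
      ← Finset.prod_filter_mul_prod_filter_not Finset.univ
        (fun e : EdgeBetween (c y) (c x) => linForm (ratio e) y x ∈ p)]
    ring

/-- The orderings in which `x` is followed only by variables of the same color
whose values modulo `p` are `q ^ k` times that of `x`. -/
noncomputable def stringIdeal (s : Finset X) (x : X) : Ideal 𝒜 :=
  Ideal.span {P | ∃ l τ : List X, (l ++ τ).Nodup ∧ (∀ a, a ∈ l ++ τ ↔ a ∈ s) ∧ x ∈ τ ∧
    (∀ y ∈ τ, c y = c x ∧ ∃ k : ℕ, linForm (q I ^ k) x y ∈ p) ∧ P = listPenalty c (l ++ τ)}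

theorem stringIdeal_le (s : Finset X) (x : X) : stringIdeal c p s x ≤ orderIdeal c s := by
  refine Ideal.span_mono ?_
  rintro P ⟨l, τ, h1, h2, -, -, h3⟩
  exact ⟨_, h1, h2, h3⟩

/-- Vanishing under `x = u y` for all edge factors `x - u y` of `penalty y x` in `p`. -/
def EdgeVanish (s : Finset X) (x : X) (G : 𝒜) : Prop :=
  ∀ y ∈ s, ∀ e ∈ badEdges c p y x,
    replace x (C (ratio e : ParamField I) * MvPolynomial.X y) G = 0

variable {c p}

theorem mem_badEdges {x y : X} {e : EdgeBetween (c y) (c x)} :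
    e ∈ badEdges c p y x ↔ linForm (ratio e) y x ∈ p := by
  simp [badEdges]

theorem mem_stringNext {s : Finset X} {x y : X} :
    y ∈ stringNext c p s x ↔ y ∈ s ∧ c y = c x ∧ linForm (q I)⁻¹ y x ∈ p := by
  simp [stringNext]

theorem stringNext_erase (s : Finset X) (x y : X) :
    stringNext c p (s.erase y) x = (stringNext c p s x).erase y := by
  ext z
  simp only [mem_stringNext, Finset.mem_erase, and_assoc]

/-- `linForm u x y ∈ p` is the congruence y ≡ u x modulo p; such congruences compose and can be
inverted. -/
theorem linForm_trans {u u' : (ParamField I)ˣ} {x y z : X} (h : linForm u x y ∈ p)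
    (h' : linForm u' y z ∈ p) : linForm (u' * u) x z ∈ p := by
  have e : (linForm (u' * u) x z : 𝒜) =
      linForm u' y z + C (u' : ParamField I) * linForm u x y := by
    simp only [linForm, Units.val_mul, map_mul]
    ring
  rw [e]
  exact p.add_mem h' (p.mul_mem_left _ h)

theorem linForm_symm {u : (ParamField I)ˣ} {x y : X} (h : linForm u x y ∈ p) :
    linForm u⁻¹ y x ∈ p := by
  have e : (linForm u⁻¹ y x : 𝒜) = -C ((u⁻¹ : (ParamField I)ˣ) : ParamField I) * linForm u x y := by
    have h1 : (C ((u⁻¹ : (ParamField I)ˣ) : ParamField I) * C (u : ParamField I) : 𝒜) = 1 := by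
      rw [← map_mul, Units.inv_mul, map_one]
    simp only [linForm]
    linear_combination (-MvPolynomial.X x) * h1
  rw [e]
  exact p.mul_mem_left _ h

/-- The form is (1 - u) x; here x is not in p, and a nonzero scalar would be a unit. -/
theorem eq_one_of_linForm_mem (hp : ∀ x, MvPolynomial.X x ∉ p) {u : (ParamField I)ˣ} {x : X}
    (h : linForm u x x ∈ p) : u = 1 := by
  by_contra hne
  have e : (linForm u x x : 𝒜) = C (1 - (u : ParamField I)) * MvPolynomial.X x := by
    simp only [linForm, map_sub, map_one]
    ring
  rw [e] at h
  rcases (‹p.IsPrime›).mem_or_mem h with h | h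
  · have hu : (1 - (u : ParamField I)) ≠ 0 := by
      rw [sub_ne_zero]
      exact fun h => hne (Units.ext h.symm)
    have h1 : (1 : 𝒜) ∈ p := by
      have := p.mul_mem_left (C (1 - (u : ParamField I))⁻¹) h
      rwa [← map_mul, inv_mul_cancel₀ hu, map_one] at this
    exact p.one_notMem h1
  · exact hp x h

/-- Comparison of the weights of two monomials by which the values of two variables differ. -/
theorem weight_unique (hp : ∀ x, MvPolynomial.X x ∉ p) {u u' : (ParamField I)ˣ} {k k' : ℤ}
    (hu : HasWeight u k) (hu' : HasWeight u' k') {x y : X} (h : linForm u x y ∈ p)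
    (h' : linForm u' x y ∈ p) : k = k' := by
  have h1 := eq_one_of_linForm_mem hp (linForm_trans h (linForm_symm h'))
  have h2 := hu'.inv.mul hu
  rw [h1] at h2
  have := h2.unique hasWeight_one
  omega

/-- The weight of y relative to x is 2k. A factor in p would force it to be -2, impossible as k ≥ 0,
or 1, impossible by parity. Thus placing x before a q-string that it starts costs nothing locally.
-/
theorem penalty_notMem (hp : ∀ x, MvPolynomial.X x ∉ p) {x y : X} {k : ℕ}
    (h : linForm (q I ^ k) x y ∈ p) : penalty c x y ∉ p := by
  have hk := hasWeight_q (I := I).pow k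
  refine p.primeCompl.mul_mem ?_ (finset_prod_notMem fun e _ he => ?_)
  · split_ifs
    · intro h'
      have := weight_unique hp hk hasWeight_q.inv h h'
      omega
    · exact p.one_notMem
  · have := weight_unique hp hk (hasWeight_ratio e) h he
    omega

/-- There is a variable without outgoing edge relations. -/
theorem exists_badEdges_eq_empty (hp : ∀ x, MvPolynomial.X x ∉ p) {s : Finset X}
    (hs : s.Nonempty) : ∃ x ∈ s, ∀ y ∈ s, badEdges c p y x = ∅ := by
  let r : {x // x ∈ s} → {x // x ∈ s} → Prop := fun x y =>
    ∃ (u : (ParamField I)ˣ) (k : ℤ), HasWeight u k ∧ 0 < k ∧ linForm u x.1 y.1 ∈ p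
  have : Std.Irrefl r := ⟨by
    rintro x ⟨u, k, hu, hk, h⟩
    have := eq_one_of_linForm_mem hp h
    subst this
    have := hu.unique hasWeight_one
    omega⟩
  have : IsTrans _ r := ⟨by
    rintro x y z ⟨u, k, hu, hk, h⟩ ⟨u', k', hu', hk', h'⟩
    exact ⟨u' * u, k' + k, hu'.mul hu, by omega, linForm_trans h h'⟩⟩
  -- A minimal x is congruent to no multiple u y with u of positive weight, whereas an edge relation
  -- would have weight 1.
  obtain ⟨x, -, hx⟩ := (Finite.wellFounded_of_trans_of_irrefl r).has_min Set.univ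
    ⟨⟨_, hs.choose_spec⟩, trivial⟩
  refine ⟨x.1, x.2, fun y hy => ?_⟩
  rw [Finset.eq_empty_iff_forall_notMem]
  intro e he
  refine hx ⟨y, hy⟩ trivial ⟨ratio e, 1, hasWeight_ratio e, one_pos, ?_⟩
  exact mem_badEdges.1 he

end Local

/-! ### The local induction, and its globalization. -/

section LocalGeneration

variable {I : Type u} [Quiver.{v} I] [DecidableEq I] [∀ i j : I, Fintype (i ⟶ j)]
  {X : Type*} [DecidableEq X] {c : X → I}

local notation "𝒜" => MvPolynomial X (ParamField I)

open MvPolynomial (C)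

variable {p : Ideal (MvPolynomial X (ParamField I))} [p.IsPrime]

/-- As a polynomial in x, G has the roots u y, and these are pairwise distinct over all y and all
edges. -/
theorem exists_eq_edgePart_mul {s : Finset X} {x : X} {G : 𝒜}
    (h : EdgeVanish c p s x G) : ∃ G', G = (∏ y ∈ s, edgePart c p y x) * G' := by
  have h1 := prod_X_sub_dvd x (s.sigma fun y => badEdges c p y x)
    (fun i => C (ratio i.2 : ParamField I) * MvPolynomial.X i.1) ?_ G ?_
  · rw [Finset.prod_sigma] at h1
    exact h1
  · rintro ⟨y, e⟩ - ⟨y', e'⟩ - h0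
    obtain ⟨h1, h2⟩ := C_mul_X_injective (ratio e).ne_zero h0
    dsimp only at h1
    subst h1
    rw [ratio_injective (Units.ext h2)]
  · rintro ⟨y, e⟩ he
    rw [Finset.mem_sigma] at he
    exact h y he.1 e he.2

/-- Here x is fixed. Another variable can become a multiple of x only if w = x; it then has weight 1
or 2, and the edge adds 1, while x has weight 0. -/
theorem wheelSub_edgePart_ne_zero {s : Finset X} {x x' y w : X} {u : (ParamField I)ˣ}
    (hu : HasWeight u 1) (hxs : x ∉ s)
    (h1 : x ≠ x') (h2 : x ≠ y) :
    wheelSub x' y w u (∏ y ∈ s, edgePart c p y x) ≠ 0 := by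
  rw [map_prod, Finset.prod_ne_zero_iff]
  intro y' hy'
  rw [edgePart, map_prod, Finset.prod_ne_zero_iff]
  intro e _
  refine wheelSub_linForm_ne_zero hu (hasWeight_ratio e) ?_
  have h3 : x ≠ y' := by
    rintro rfl
    exact hxs hy'
  split_ifs <;> grind

theorem prod_qPart (t : Finset X) (x : X) :
    ∏ y ∈ t, qPart c p y x = ∏ y ∈ stringNext c p t x,
      (MvPolynomial.X x - C (((q I)⁻¹ : (ParamField I)ˣ) : ParamField I) * MvPolynomial.X y) := by
  classical
  rw [stringNext, Finset.prod_filter]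
  refine Finset.prod_congr rfl fun y _ => ?_
  unfold qPart linForm
  split_ifs <;> rfl

/-- Append x to each ordering of s. Up to local units, the new factors are exactly the edge and q
parts of all pairs (y, x). -/
theorem mul_vandermonde_mem_stringIdeal_of_quotient {s : Finset X} {x : X} (hx : x ∉ s) {g : 𝒜}
    (h : g * vandermonde c s.toList ∈ saturation p (orderIdeal c s)) :
    (∏ y ∈ s, edgePart c p y x) * (∏ y ∈ s, qPart c p y x) * (g * vandermonde c s.toList) ∈
      saturation p (stringIdeal c p (insert x s) x) := by
  refine mul_mem_saturation_of_span ?_ h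
  rintro P ⟨l, hl, hls, rfl⟩
  choose f hf hfe using fun y => exists_penalty_eq c p y x
  apply mem_saturation_of_mul_mem (u := ∏ y ∈ s, f y) (finset_prod_notMem fun y _ => hf y)
  apply le_saturation
  apply Ideal.subset_span
  have hnd : (l ++ [x]).Nodup := by
    rw [List.nodup_append]
    refine ⟨hl, by simp, ?_⟩
    rintro a ha b hb rfl
    rw [List.mem_singleton] at hb
    exact hx (hb ▸ (hls a).1 ha)
  refine ⟨l, [x], hnd, ?_, by simp, ?_, ?_⟩
  · intro a
    rw [List.mem_append, hls, Finset.mem_insert, List.mem_singleton, or_comm]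
  · intro y hy
    rw [List.mem_singleton] at hy
    subst hy
    exact ⟨rfl, 0, by simp [linForm]⟩
  · rw [listPenalty_insert]
    have e : (l.map fun y => penalty c y x).prod = ∏ y ∈ s, penalty c y x := by
      have : s = l.toFinset := by
        ext a
        rw [List.mem_toFinset, hls]
      rw [this, List.prod_toFinset _ hl]
    rw [e]
    simp only [hfe, Finset.prod_mul_distrib, List.append_nil, List.map_nil, List.prod_nil, mul_one]
    ring

/-- Since x' ≡ q x, inserting x right before the final block τ containing x' again gives a q-string.
The factors between x and τ are local units, so only those from variables before τ are needed. As x'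
lies in τ, the factor x - x' / q is not among them. -/
theorem mul_mem_stringIdeal_of_string (hp : ∀ x, MvPolynomial.X x ∉ p) {s : Finset X} {x x' : X}
    (hx : x ∉ s) (hx' : x' ∈ s) (hc : c x' = c x) (hxx' : linForm (q I)⁻¹ x' x ∈ p) {F : 𝒜}
    (h : F ∈ saturation p (stringIdeal c p s x')) :
    (∏ y ∈ s, edgePart c p y x) * (∏ y ∈ s.erase x', qPart c p y x) * F ∈
      saturation p (stringIdeal c p (insert x s) x) := by
  refine mul_mem_saturation_of_span ?_ h
  rintro P ⟨l, τ, hnd, hs, hτ, hq, rfl⟩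
  choose f hf hfe using fun y => exists_penalty_eq c p y x
  have hqx : ∀ y ∈ τ, ∃ k : ℕ, linForm (q I ^ k) x y ∈ p := by
    intro y hy
    obtain ⟨-, k, hk⟩ := hq y hy
    refine ⟨k + 1, ?_⟩
    have h1 := linForm_trans (linForm_symm hxx') hk
    rwa [inv_inv, ← pow_succ] at h1
  have hls : l.toFinset ⊆ s.erase x' := by
    intro a ha
    rw [List.mem_toFinset] at ha
    rw [Finset.mem_erase]
    refine ⟨?_, (hs a).1 (List.mem_append_left _ ha)⟩
    rintro rfl
    exact (List.nodup_append.1 hnd).2.2 a ha a hτ rfl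
  have hlnd : l.Nodup := (List.nodup_append.1 hnd).1
  apply mem_saturation_of_mul_mem (u := (∏ y ∈ l.toFinset, f y) * (τ.map (penalty c x)).prod)
  · refine p.primeCompl.mul_mem (finset_prod_notMem fun y _ => hf y) (list_prod_notMem ?_)
    intro a ha
    obtain ⟨y, hy, rfl⟩ := List.mem_map.1 ha
    obtain ⟨k, hk⟩ := hqx y hy
    exact penalty_notMem hp hk
  apply le_saturation
  have hmem : listPenalty c (l ++ x :: τ) ∈ stringIdeal c p (insert x s) x := by
    apply Ideal.subset_span
    refine ⟨l, x :: τ, ?_, ?_, by simp, ?_, rfl⟩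
    · rw [List.nodup_middle, List.nodup_cons]
      exact ⟨fun h => hx ((hs x).1 h), hnd⟩
    · intro a
      rw [List.mem_append, List.mem_cons, Finset.mem_insert, ← hs, List.mem_append]
      tauto
    · intro y hy
      rcases List.mem_cons.1 hy with rfl | hy
      · exact ⟨rfl, 0, by simp [linForm]⟩
      · exact ⟨(hq y hy).1.trans hc, hqx y hy⟩
  refine Ideal.mem_of_dvd _ ?_ hmem
  rw [listPenalty_insert]
  have e : (l.map fun y => penalty c y x).prod = ∏ y ∈ l.toFinset, penalty c y x := by
    rw [List.prod_toFinset _ hlnd]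
  rw [e]
  simp only [hfe, Finset.prod_mul_distrib]
  obtain ⟨a, ha⟩ : ∏ y ∈ l.toFinset, qPart c p y x ∣ ∏ y ∈ s.erase x', qPart c p y x :=
    Finset.prod_dvd_prod_of_subset _ _ _ hls
  obtain ⟨b, hb⟩ : ∏ y ∈ l.toFinset, edgePart c p y x ∣ ∏ y ∈ s, edgePart c p y x :=
    Finset.prod_dvd_prod_of_subset _ _ _ (hls.trans (Finset.erase_subset _ _))
  rw [ha, hb]
  exact ⟨a * b, by ring⟩

/-- The Lagrange denominators at the node x' / q are, up to scalars, color differences involving x'.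
They divide the part of V lost when x' is erased, so the cofactor D keeps the Vandermonde product of
the remaining variables. -/
theorem exists_vandermonde_eq {s : Finset X} {x x' : X} (hx' : x' ∈ stringNext c p s x) :
    ∃ D : 𝒜, vandermonde c s.toList = (∏ y ∈ (stringNext c p s x).erase x',
      (C (((q I)⁻¹ : (ParamField I)ˣ) : ParamField I) * MvPolynomial.X x' -
        C (((q I)⁻¹ : (ParamField I)ˣ) : ParamField I) * MvPolynomial.X y)) * D ∧
      vandermonde c (s.erase x').toList ∣ D := by
  obtain ⟨hs, hc, -⟩ := mem_stringNext.1 hx'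
  have h1 : ∏ y ∈ (stringNext c p s x).erase x',
      (C (((q I)⁻¹ : (ParamField I)ˣ) : ParamField I) * MvPolynomial.X x' -
        C (((q I)⁻¹ : (ParamField I)ˣ) : ParamField I) * MvPolynomial.X y) ∣
      ∏ y ∈ s.erase x', colorDiff c x' y := by
    refine dvd_trans (Finset.prod_dvd_prod_of_dvd _ (colorDiff c x') ?_)
      (Finset.prod_dvd_prod_of_subset _ _ _ ?_)
    · intro y hy
      obtain ⟨-, hy2, -⟩ := mem_stringNext.1 (Finset.mem_of_mem_erase hy)
      rw [colorDiff, if_pos (hc.trans hy2.symm)]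
      refine ⟨-C (q I : ParamField I), ?_⟩
      have h1 : (C ((q I : (ParamField I)ˣ) : ParamField I) *
          C (((q I)⁻¹ : (ParamField I)ˣ) : ParamField I) : 𝒜) = 1 := by
        rw [← map_mul, Units.mul_inv, map_one]
      linear_combination (MvPolynomial.X x' - MvPolynomial.X y) * h1
    · intro y hy
      rw [← stringNext_erase] at hy
      exact (mem_stringNext.1 hy).1
  obtain ⟨a, ha⟩ := h1
  obtain ⟨u, hu⟩ := (vandermonde_erase c s hs).symm
  refine ⟨vandermonde c (s.erase x').toList * (a * u), ?_, Dvd.intro _ rfl⟩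
  rw [← hu, ha]
  ring

/-- For x of lowest weight, the condition on edge relations is vacuous, and the string statement
applies to s without x. The extra Vandermonde factors involving x are only a multiplier. -/
theorem mul_vandermonde_mem_saturation_of_lt {s : Finset X} {N : ℕ}
    (hp : ∀ x, MvPolynomial.X x ∉ p) (hN : s.card ≤ N)
    (h : ∀ (s : Finset X) (x : X), x ∉ s → s.card + 1 ≤ N → ∀ G : 𝒜, WheelOn c (insert x s) G →
      EdgeVanish c p s x G →
      G * vandermonde c s.toList ∈ saturation p (stringIdeal c p (insert x s) x))
    (G : 𝒜) (hG : WheelOn c s G) :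
    G * vandermonde c s.toList ∈ saturation p (orderIdeal c s) := by
  rcases s.eq_empty_or_nonempty with rfl | hs
  · apply le_saturation
    apply Ideal.mul_mem_right
    have : (1 : 𝒜) ∈ orderIdeal c ∅ :=
      Ideal.subset_span ⟨[], by simp, by simp, by simp [listPenalty]⟩
    simpa using Ideal.mul_mem_left _ G this
  obtain ⟨x, hx, hbad⟩ := exists_badEdges_eq_empty (c := c) hp hs
  have h1 := h (s.erase x) x (Finset.notMem_erase x s)
    (by rwa [Finset.card_erase_add_one hx]) G (by rwa [Finset.insert_erase hx])
    (fun y hy e he => by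
      rw [hbad y (Finset.mem_of_mem_erase hy)] at he
      exact absurd he (Finset.notMem_empty e))
  rw [Finset.insert_erase hx] at h1
  obtain ⟨u, hu⟩ := (vandermonde_erase c s hx).symm
  rw [← hu]
  have h2 : G * vandermonde c (s.erase x).toList ∈ saturation p (orderIdeal c s) := by
    obtain ⟨f, hf, h3⟩ := h1
    exact ⟨f, hf, stringIdeal_le c p s x h3⟩
  refine Ideal.mem_of_dvd _ ?_ h2
  exact ⟨(∏ y ∈ s.erase x, colorDiff c x y) * u, by ring⟩

/-- The inductive step: the interpolation quotient uses `h1` for s, and the term at the node x' / q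
uses `h2` for x'. Only the Vandermonde product of s is available, and it is exactly enough for the
denominators. -/
theorem mul_vandermonde_mem_stringIdeal_of_lt {s : Finset X} {x : X}
    (hp : ∀ x, MvPolynomial.X x ∉ p) (hx : x ∉ s)
    (h1 : ∀ G : 𝒜, WheelOn c s G → G * vandermonde c s.toList ∈ saturation p (orderIdeal c s))
    (h2 : ∀ x' ∈ s, ∀ G : 𝒜, WheelOn c s G → EdgeVanish c p (s.erase x') x' G →
      G * vandermonde c (s.erase x').toList ∈ saturation p (stringIdeal c p s x'))
    (G : 𝒜) (hG : WheelOn c (insert x s) G) (hGe : EdgeVanish c p s x G) :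
    G * vandermonde c s.toList ∈ saturation p (stringIdeal c p (insert x s) x) := by
  -- From here on G is the quotient by the edge factors; it inherits the wheel conditions needed
  -- below because these factors do not vanish there.
  obtain ⟨G, rfl⟩ := exists_eq_edgePart_mul hGe
  have hws : WheelOn c s G := by
    intro a ha b hb w hw haw hab hbw hc e
    have h3 := hG a (Finset.mem_insert_of_mem ha) b (Finset.mem_insert_of_mem hb) w
      (Finset.mem_insert_of_mem hw) haw hab hbw hc e
    rw [map_mul] at h3
    refine (mul_eq_zero.1 h3).resolve_left (wheelSub_edgePart_ne_zero (hasWeight_ratio e) hx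
      ?_ ?_)
    · rintro rfl; exact hx ha
    · rintro rfl; exact hx hb
  -- The wheels a = q x, b = (q / u) x; they control the restrictions x = x' / q.
  have hwx : ∀ a ∈ s, ∀ b ∈ s, a ≠ b → c a = c x → ∀ e : EdgeBetween (c b) (c a),
      wheelSub a b x (ratio e) G = 0 := by
    intro a ha b hb hab hc e
    have hax : a ≠ x := by rintro rfl; exact hx ha
    have hbx : b ≠ x := by rintro rfl; exact hx hb
    have h3 := hG a (Finset.mem_insert_of_mem ha) b (Finset.mem_insert_of_mem hb) x
      (Finset.mem_insert_self x s) hax hab hbx hc e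
    rw [map_mul] at h3
    exact (mul_eq_zero.1 h3).resolve_left (wheelSub_edgePart_ne_zero (hasWeight_ratio e) hx
      hax.symm hbx.symm)
  -- The nodes are y / q for those y of the color of x with y ≡ q x modulo p.
  obtain ⟨g, hg, hD⟩ := exists_interpolation x (stringNext c p s x)
    (fun y => C (((q I)⁻¹ : (ParamField I)ˣ) : ParamField I) * MvPolynomial.X y)
    (fun y _ y' _ h => (C_mul_X_injective (q I)⁻¹.ne_zero h).1) G
  have hgw : WheelOn c s g := by
    intro a ha b hb w hw haw hab hbw hc e
    have hxa : x ≠ a := by rintro rfl; exact hx ha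
    have hxb : x ≠ b := by rintro rfl; exact hx hb
    have hxw : x ≠ w := by rintro rfl; exact hx hw
    exact hg _ (wheelSub_X_of_ne hxa hxb _) (isolate_wheelSub _ hxw)
      (hws a ha b hb w hw haw hab hbw hc e)
  choose! D' hD' hD'' using fun x' (hx' : x' ∈ stringNext c p s x) =>
    exists_vandermonde_eq (c := c) hx'
  rw [mul_assoc, mul_comm G, hD _ D' hD', mul_add]
  refine add_mem ?_ ?_
  · have h3 := mul_vandermonde_mem_stringIdeal_of_quotient hx (h1 g hgw)
    rw [prod_qPart] at h3
    convert h3 using 1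
    ring
  · rw [Finset.mul_sum]
    refine sum_mem fun x' hx' => ?_
    obtain ⟨hxs', hc', hl'⟩ := mem_stringNext.1 hx'
    have hxx' : x ≠ x' := by rintro rfl; exact hx hxs'
    set G₁ := replace x (C (((q I)⁻¹ : (ParamField I)ˣ) : ParamField I) * MvPolynomial.X x') G
      with hG₁
    have h3 : WheelOn c s G₁ := by
      intro a ha b hb w hw haw hab hbw hc e
      have hxa : x ≠ a := by rintro rfl; exact hx ha
      have hxb : x ≠ b := by rintro rfl; exact hx hb
      have hxw : x ≠ w := by rintro rfl; exact hx hw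
      rw [hG₁, wheelSub_replace _ hxa hxb hxw, hws a ha b hb w hw haw hab hbw hc e, map_zero]
    have h4 : EdgeVanish c p (s.erase x') x' G₁ := by
      intro y hy e he
      obtain ⟨hyx', hys⟩ := Finset.mem_erase.1 hy
      have hxy : x ≠ y := by rintro rfl; exact hx hys
      have hqq : (C (q I : ParamField I) * C (((q I)⁻¹ : (ParamField I)ˣ) : ParamField I) : 𝒜)
          = 1 := by
        rw [← map_mul, Units.mul_inv, map_one]
      have hrr : (C (ratio e : ParamField I) *
          C (((ratio e)⁻¹ : (ParamField I)ˣ) : ParamField I) : 𝒜) = 1 := by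
        rw [← map_mul, Units.mul_inv, map_one]
      -- On the locus x = x' / q, x' = u y one has x' = q x and y = (q / u) x. The composite
      -- restriction therefore factors through a wheel substitution.
      have hcomp : (replace x' (C (ratio e : ParamField I) * MvPolynomial.X y)).comp
          (replace x (C (((q I)⁻¹ : (ParamField I)ˣ) : ParamField I) * MvPolynomial.X x')) =
          (replace x (C (((q I)⁻¹ : (ParamField I)ˣ) : ParamField I) *
            (C (ratio e : ParamField I) * MvPolynomial.X y))).comp (wheelSub x' y x (ratio e)) := by
        have hC : ∀ (a : X) (b : 𝒜) (k : ParamField I), replace a b (C k) = C k := by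
          intro a b k
          rw [← MvPolynomial.algebraMap_eq, AlgHom.commutes]
        apply MvPolynomial.algHom_ext
        intro v
        simp only [AlgHom.comp_apply]
        by_cases hv1 : v = x
        · subst hv1
          rw [replace_X_self, wheelSub_X_of_ne hxx' hxy, replace_X_self, map_mul, replace_X_self,
            hC]
        rw [replace_X_of_ne hv1]
        by_cases hv2 : v = x'
        · subst hv2
          have : wheelSub v y x (ratio e) (MvPolynomial.X v) =
              C (q I : ParamField I) * MvPolynomial.X x := by simp [wheelSub]
          rw [replace_X_self, this, map_mul, hC, replace_X_self]
          linear_combination (-C (ratio e : ParamField I) * MvPolynomial.X y) * hqq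
        rw [replace_X_of_ne hv2]
        by_cases hv3 : v = y
        · subst hv3
          have : wheelSub x' v x (ratio e) (MvPolynomial.X v) =
              C ((q I * (ratio e)⁻¹ : (ParamField I)ˣ) : ParamField I) * MvPolynomial.X x := by
            simp [wheelSub, hv2, div_eq_mul_inv]
          rw [this, map_mul, hC, replace_X_self, Units.val_mul, map_mul]
          linear_combination (-MvPolynomial.X v) * hrr - (MvPolynomial.X v) *
            C (ratio e : ParamField I) * C (((ratio e)⁻¹ : (ParamField I)ˣ) : ParamField I) * hqq
        · rw [wheelSub_X_of_ne hv2 hv3, replace_X_of_ne hv1]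
      have h5 := congrArg (fun f : 𝒜 →ₐ[ParamField I] 𝒜 => f G) hcomp
      simp only [AlgHom.comp_apply] at h5
      rw [hG₁, h5, hwx x' hxs' y hys (Ne.symm hyx') hc' e, map_zero]
    have h5 := mul_mem_stringIdeal_of_string hp hx hxs' hc' hl' (h2 x' hxs' G₁ h3 h4)
    rw [prod_qPart, stringNext_erase] at h5
    refine Ideal.mem_of_dvd _ ?_ h5
    obtain ⟨a, ha⟩ := hD'' x' hx'
    exact ⟨a, by rw [ha]; ring⟩

/-- The generation statement in a localization, for the orderings of `s` and for those orderings
of `insert x s` in which `x` is followed by a `q`-string only. -/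
theorem mul_vandermonde_mem_saturation_aux (hp : ∀ x, MvPolynomial.X x ∉ p) (N : ℕ) :
    (∀ s : Finset X, s.card ≤ N → ∀ G : 𝒜, WheelOn c s G →
      G * vandermonde c s.toList ∈ saturation p (orderIdeal c s)) ∧
    ∀ (s : Finset X) (x : X), x ∉ s → s.card ≤ N → ∀ G : 𝒜, WheelOn c (insert x s) G →
      EdgeVanish c p s x G →
      G * vandermonde c s.toList ∈ saturation p (stringIdeal c p (insert x s) x) := by
  induction N with
  | zero =>
    have h : ∀ s : Finset X, s.card ≤ 0 → ∀ G : 𝒜, WheelOn c s G →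
        G * vandermonde c s.toList ∈ saturation p (orderIdeal c s) := fun s hs G hG =>
      mul_vandermonde_mem_saturation_of_lt hp hs (fun s x _ hs => by omega) G hG
    refine ⟨h, fun s x hx hs G hG hGe => ?_⟩
    refine mul_vandermonde_mem_stringIdeal_of_lt hp hx (h s hs) ?_ G hG hGe
    rw [Nat.le_zero, Finset.card_eq_zero] at hs
    simp [hs]
  | succ N ih =>
    -- The ordering statement at size N + 1 needs the string statement only at size N; it is then
    -- used at size N + 1 to prove the string statement.
    have h : ∀ s : Finset X, s.card ≤ N + 1 → ∀ G : 𝒜, WheelOn c s G →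
        G * vandermonde c s.toList ∈ saturation p (orderIdeal c s) := fun s hs G hG =>
      mul_vandermonde_mem_saturation_of_lt hp hs
        (fun s x hx hs => ih.2 s x hx (by omega)) G hG
    refine ⟨h, fun s x hx hs G hG hGe => ?_⟩
    refine mul_vandermonde_mem_stringIdeal_of_lt hp hx (h s hs) (fun x' hx' G hG hGe => ?_) G hG hGe
    have h1 := ih.2 (s.erase x') x' (Finset.notMem_erase x' s)
      (by have := Finset.card_erase_add_one hx'; omega) G (by rwa [Finset.insert_erase hx']) hGe
    rwa [Finset.insert_erase hx'] at h1

/-- A polynomial satisfying the wheel conditions, multiplied by the Vandermonde determinants and a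
power of the product of the variables, is a combination of products of penalties. -/
theorem exists_pow_mul_mem_orderIdeal [Fintype X] (G : 𝒜) (hG : WheelOn c Finset.univ G) :
    ∃ N : ℕ, (∏ x, MvPolynomial.X x : 𝒜) ^ N * (G * vandermonde c Finset.univ.toList) ∈
      orderIdeal c (Finset.univ : Finset X) := by
  by_contra! h
  set V : 𝒜 := G * vandermonde c Finset.univ.toList
  -- The multipliers taking G V into the order ideal. If K contained no power of the product of the
  -- variables, some prime p ⊇ K would avoid that product, but the local statement yields an element
  -- of K outside p.
  let K : Ideal 𝒜 := Submodule.comap (LinearMap.mulRight 𝒜 V)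
    (orderIdeal c (Finset.univ : Finset X))
  have hdisj : Disjoint (K : Set 𝒜) (Submonoid.powers (∏ x, MvPolynomial.X x : 𝒜)) := by
    rw [Set.disjoint_left]
    rintro _ hK ⟨N, rfl⟩
    exact h N hK
  obtain ⟨p, hp, hle, hpd⟩ := Ideal.exists_le_prime_disjoint K _ hdisj
  have hX : ∀ x, (MvPolynomial.X x : 𝒜) ∉ p := by
    intro x hx
    have h1 : (∏ x, MvPolynomial.X x : 𝒜) ∉ (p : Set 𝒜) := fun h1 =>
      Set.disjoint_left.1 hpd h1 ⟨1, pow_one _⟩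
    apply h1
    exact Ideal.mem_of_dvd _ (Finset.dvd_prod_of_mem _ (Finset.mem_univ x)) hx
  obtain ⟨f, hf, hfV⟩ := (mul_vandermonde_mem_saturation_aux (p := p) hX _).1 Finset.univ le_rfl G hG
  exact hf (hle hfV)

end LocalGeneration

/-! ### Passing between Laurent polynomials, polynomials and rational functions. -/

section Laurent

variable {I : Type u} [Quiver.{v} I]

instance : CharZero (ParamField I) :=
  charZero_of_injective_algebraMap
    (IsFractionRing.injective (MvPolynomial (Option (Quiver.Total I)) ℚ) (ParamField I))

variable {n m : I → ℕ}

/-- The embedding of polynomials into rational functions. -/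
noncomputable def toRat (n : I → ℕ) :
    MvPolynomial (VarIdx n) (ParamField I) →ₐ[ParamField I] RatFun n :=
  IsScalarTower.toAlgHom _ _ _

theorem toRat_injective : Function.Injective (toRat n) :=
  IsFractionRing.injective (MvPolynomial (VarIdx n) (ParamField I)) (RatFun n)

theorem toRat_ne_zero {f : MvPolynomial (VarIdx n) (ParamField I)} (h : f ≠ 0) :
    toRat n f ≠ 0 :=
  (map_ne_zero_iff _ toRat_injective).2 h

@[simp] theorem toRat_X (x : VarIdx n) : toRat n (MvPolynomial.X x) = z x := rfl

@[simp] theorem toRat_C (a : ParamField I) :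
    toRat n (MvPolynomial.C a) = algebraMap _ _ a := (toRat n).commutes a

theorem toRat_eq_aeval : toRat n = MvPolynomial.aeval fun x => (z x : RatFun n) := by
  apply MvPolynomial.algHom_ext
  intro x
  simp

theorem ratRename_toRat (f : VarIdx n ↪ VarIdx m) (P : MvPolynomial (VarIdx n) (ParamField I)) :
    ratRename f (toRat n P) = toRat m (MvPolynomial.rename f P) := by
  have h : Function.Injective ((IsScalarTower.toAlgHom (ParamField I)
      (MvPolynomial (VarIdx m) (ParamField I)) (RatFun m)).comp (MvPolynomial.rename f)) :=
    toRat_injective.comp (MvPolynomial.rename_injective f f.injective)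
  exact IsFractionRing.lift_algebraMap h P

@[simp] theorem ratRename_z (f : VarIdx n ↪ VarIdx m) (x : VarIdx n) :
    ratRename f (z x : RatFun n) = z (f x) := by
  rw [← toRat_X, ratRename_toRat, MvPolynomial.rename_X, toRat_X]

theorem units_map_ratRename_z (f : VarIdx n ↪ VarIdx m) (x : VarIdx n) :
    Units.map (ratRename f).toRingHom.toMonoidHom (z x) = z (f x) :=
  Units.ext (ratRename_z f x)

variable [Fintype I]

theorem subst_single (w : VarIdx n → (RatFun m)ˣ) (k : VarIdx n →₀ ℤ) (a : ParamField I) :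
    subst w (AddMonoidAlgebra.single k a) =
      algebraMap _ _ a * ∏ x, (w x : RatFun m) ^ k x := by
  rw [subst, AddMonoidAlgebra.lift_single, Algebra.smul_def]
  congr 1
  change ((k.prod fun x d => w x ^ d : (RatFun m)ˣ) : RatFun m) = _
  rw [Finsupp.prod_fintype _ _ (by simp)]
  simp

theorem ratRename_subst {m' : I → ℕ} (f : VarIdx m ↪ VarIdx m') (w : VarIdx n → (RatFun m)ˣ)
    (R : Laurent n) :
    ratRename f (subst w R) =
      subst (fun x => Units.map (ratRename f).toRingHom.toMonoidHom (w x)) R := by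
  induction R using AddMonoidAlgebra.induction_linear with
  | zero => simp
  | add R R' h h' => simp only [map_add, h, h']
  | single k a =>
    rw [subst_single, subst_single, map_mul, AlgHom.commutes, map_prod]
    simp

theorem ratRename_subst_z (f : VarIdx n ↪ VarIdx m) (R : Laurent n) :
    ratRename f (subst z R) = subst (fun x => z (f x)) R := by
  rw [ratRename_subst]
  simp only [units_map_ratRename_z]

/-- Every Laurent polynomial becomes a polynomial after multiplication with a monomial. -/
theorem exists_aeval_eq_subst_mul (R : Laurent n) :
    ∃ (N : ℕ) (f : MvPolynomial (VarIdx n) (ParamField I)),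
      ∀ w : VarIdx n → (RatFun n)ˣ, MvPolynomial.aeval (fun x => (w x : RatFun n)) f =
        subst w R * ∏ x, (w x : RatFun n) ^ N := by
  induction R using AddMonoidAlgebra.induction_linear with
  | zero => exact ⟨0, 0, by simp⟩
  | add R R' h h' =>
    obtain ⟨N, f, hf⟩ := h
    obtain ⟨N', f', hf'⟩ := h'
    refine ⟨N + N', f * (∏ x, MvPolynomial.X x ^ N') + f' * ∏ x, MvPolynomial.X x ^ N,
      fun w => ?_⟩
    simp only [map_add, map_mul, map_prod, map_pow, MvPolynomial.aeval_X, hf, hf', pow_add,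
      Finset.prod_mul_distrib]
    ring
  | single k a =>
    -- This N bounds every |k x|, so no exponent k x + N is negative.
    refine ⟨∑ x, (k x).natAbs, MvPolynomial.C a *
      ∏ x, MvPolynomial.X x ^ (k x + (∑ x, (k x).natAbs : ℕ)).toNat, fun w => ?_⟩
    rw [subst_single, map_mul, MvPolynomial.aeval_C, map_prod, mul_assoc,
      ← Finset.prod_mul_distrib]
    congr 1
    refine Finset.prod_congr rfl fun x _ => ?_
    rw [map_pow, MvPolynomial.aeval_X, ← zpow_natCast, ← zpow_natCast,
      ← zpow_add₀ (w x).ne_zero, Int.toNat_of_nonneg]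
    have h1 := Finset.single_le_sum (f := fun x => (k x).natAbs) (fun _ _ => Nat.zero_le _)
      (Finset.mem_univ x)
    omega

theorem exists_subst_mul_eq_aeval (f : MvPolynomial (VarIdx n) (ParamField I)) (N : ℕ) :
    ∃ R : Laurent n, ∀ w : VarIdx n → (RatFun n)ˣ,
      subst w R * ∏ x, (w x : RatFun n) ^ N = MvPolynomial.aeval (fun x => (w x : RatFun n)) f := by
  induction f using MvPolynomial.induction_on' with
  | monomial k a =>
    refine ⟨AddMonoidAlgebra.single (Finsupp.equivFunOnFinite.symm fun x => (k x - N : ℤ)) a,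
      fun w => ?_⟩
    rw [subst_single, mul_assoc, ← Finset.prod_mul_distrib, MvPolynomial.aeval_monomial,
      Finsupp.prod_fintype _ _ (by simp)]
    congr 1
    refine Finset.prod_congr rfl fun x _ => ?_
    simp [← zpow_natCast, ← zpow_add₀ (w x).ne_zero]
  | add f f' hf hf' =>
    obtain ⟨R, hR⟩ := hf
    obtain ⟨R', hR'⟩ := hf'
    exact ⟨R + R', fun w => by rw [map_add, add_mul, hR, hR', map_add]⟩

/-- The Laurent polynomials among the rational functions. -/
noncomputable def laurentRange (n : I → ℕ) : Subalgebra (ParamField I) (RatFun n) :=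
  (subst (z : VarIdx n → (RatFun n)ˣ)).range

theorem toRat_mem_laurentRange (f : MvPolynomial (VarIdx n) (ParamField I)) :
    toRat n f ∈ laurentRange n := by
  obtain ⟨R, hR⟩ := exists_subst_mul_eq_aeval f 0
  exact ⟨R, by simpa [toRat_eq_aeval] using hR z⟩

theorem z_zpow_mem_laurentRange (x : VarIdx n) (d : ℤ) :
    (z x : RatFun n) ^ d ∈ laurentRange n := by
  classical
  refine ⟨AddMonoidAlgebra.single (Finsupp.single x d) 1, ?_⟩
  change subst z _ = _
  rw [subst_single, map_one, one_mul, Finset.prod_eq_single x]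
  · simp
  · intro y _ hy
    simp [Finsupp.single_eq_of_ne hy]
  · simp

theorem ratRename_mem_laurentRange (f : VarIdx n ↪ VarIdx m) {F : RatFun n}
    (hF : F ∈ laurentRange n) : ratRename f F ∈ laurentRange m := by
  obtain ⟨R, rfl⟩ := hF
  change ratRename f (subst z R) ∈ _
  rw [ratRename_subst_z]
  induction R using AddMonoidAlgebra.induction_linear with
  | zero => simp
  | add R R' h h' =>
    rw [map_add]
    exact add_mem h h'
  | single k a =>
    rw [subst_single]
    exact mul_mem (Subalgebra.algebraMap_mem _ a)
      (prod_mem fun x _ => z_zpow_mem_laurentRange (f x) (k x))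

variable [DecidableEq I]

theorem scal_val (c : (ParamField I)ˣ) :
    ((scal n c : (RatFun n)ˣ) : RatFun n) = algebraMap _ _ (c : ParamField I) := rfl

theorem toRat_wheelSub (x y w : VarIdx n) (u : (ParamField I)ˣ)
    (f : MvPolynomial (VarIdx n) (ParamField I)) :
    toRat n (wheelSub x y w u f) = MvPolynomial.aeval (fun v =>
      ((if v = x then scal n (q I) * z w else if v = y then scal n (q I / u) * z w else z v :
        (RatFun n)ˣ) : RatFun n)) f := by
  rw [← AlgHom.comp_apply]
  congr 1
  apply MvPolynomial.algHom_ext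
  intro v
  rw [AlgHom.comp_apply, wheelSub, MvPolynomial.aeval_X, MvPolynomial.aeval_X]
  split_ifs
  · rw [map_mul, toRat_C, toRat_X, Units.val_mul, scal_val]
  · rw [map_mul, toRat_C, toRat_X, Units.val_mul, scal_val]
  · exact toRat_X v

theorem restrict_mul_eq {R : Laurent n} {N : ℕ} {f : MvPolynomial (VarIdx n) (ParamField I)}
    (h : ∀ w : VarIdx n → (RatFun n)ˣ, MvPolynomial.aeval (fun x => (w x : RatFun n)) f =
        subst w R * ∏ x, (w x : RatFun n) ^ N) (x y w : VarIdx n) (u : (ParamField I)ˣ) :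
    wheelSub x y w u f = 0 ↔ restrict x y w (q I / u) R = 0 := by
  rw [← map_eq_zero_iff _ toRat_injective, toRat_wheelSub, h, mul_eq_zero, restrict,
    or_iff_left]
  exact Finset.prod_ne_zero_iff.2 fun v _ => pow_ne_zero _ (Units.ne_zero _)

/-- Since `h` holds for every substitution, it holds for the wheel substitutions, where the monomial
stays nonzero. The ratio t_e gives the second family of wheel conditions; q / t_e gives the first,
as q / (q / t_e) = t_e. -/
theorem wheel_iff {R : Laurent n} {N : ℕ} {f : MvPolynomial (VarIdx n) (ParamField I)}
    (h : ∀ w : VarIdx n → (RatFun n)ˣ, MvPolynomial.aeval (fun x => (w x : RatFun n)) f =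
        subst w R * ∏ x, (w x : RatFun n) ^ N) :
    Wheel R ↔ WheelOn (Sigma.fst : VarIdx n → I) Finset.univ f := by
  constructor
  · rintro hW ⟨i, a⟩ - ⟨j, b⟩ - ⟨i', a'⟩ - haw hab hbw hc e
    dsimp only at hc e
    subst hc
    rw [restrict_mul_eq h]
    have haw' : a ≠ a' := by
      rintro rfl
      exact haw rfl
    rcases e with e | e
    · exact (hW _ _ e).2 a a' b haw' hab hbw
    · have := (hW _ _ e).1 a a' b haw' hab hbw
      simpa [ratio] using this
  · intro hW i j e
    constructor
    · intro a a' b haw hab hbw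
      have := hW ⟨i, a⟩ (Finset.mem_univ _) ⟨j, b⟩ (Finset.mem_univ _) ⟨i, a'⟩ (Finset.mem_univ _)
        (by simpa using haw) hab hbw rfl (Sum.inr e)
      rw [restrict_mul_eq h] at this
      simpa [ratio] using this
    · intro a a' b haw hab hbw
      have := hW ⟨j, a⟩ (Finset.mem_univ _) ⟨i, b⟩ (Finset.mem_univ _) ⟨j, a'⟩ (Finset.mem_univ _)
        (by simpa using haw) hab hbw rfl (Sum.inl e)
      rw [restrict_mul_eq h] at this
      simpa [ratio] using this

end Laurent

/-! ### Symmetrized words and their shuffle products. -/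

section Words

variable {I : Type u} [Quiver.{v} I] {n m : I → ℕ}

theorem ratRename_ratRename {k : I → ℕ} (f : VarIdx n ↪ VarIdx m) (g : VarIdx m ↪ VarIdx k)
    (F : RatFun n) : ratRename g (ratRename f F) = ratRename (f.trans g) F := by
  obtain ⟨a, b, hb, rfl⟩ :=
    IsFractionRing.div_surjective (A := MvPolynomial (VarIdx n) (ParamField I)) F
  have h : ∀ P : MvPolynomial (VarIdx n) (ParamField I),
      ratRename g (ratRename f (toRat n P)) = ratRename (f.trans g) (toRat n P) := by
    intro P
    rw [ratRename_toRat, ratRename_toRat, ratRename_toRat, MvPolynomial.rename_rename]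
    rfl
  have e : ∀ P, algebraMap (MvPolynomial (VarIdx n) (ParamField I)) (RatFun n) P = toRat n P :=
    fun _ => rfl
  rw [e, e]
  simp only [map_div₀, h]

theorem ratRename_eq_self {f : VarIdx n ↪ VarIdx n} (hf : ∀ x, f x = x) (F : RatFun n) :
    ratRename f F = F := by
  obtain ⟨a, b, hb, rfl⟩ :=
    IsFractionRing.div_surjective (A := MvPolynomial (VarIdx n) (ParamField I)) F
  have h : ∀ P : MvPolynomial (VarIdx n) (ParamField I),
      ratRename f (toRat n P) = toRat n P := by
    intro P
    have : (f : VarIdx n → VarIdx n) = id := funext hf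
    rw [ratRename_toRat, this, MvPolynomial.rename_id_apply]
  have e : ∀ P, algebraMap (MvPolynomial (VarIdx n) (ParamField I)) (RatFun n) P = toRat n P :=
    fun _ => rfl
  rw [e, e]
  simp only [map_div₀, h]

theorem z_injective : Function.Injective (fun x : VarIdx n => (z x : RatFun n)) := by
  intro x y h
  exact MvPolynomial.X_injective (toRat_injective h)

variable [Fintype I] [DecidableEq I]

theorem symmetrize_apply (F : RatFun n) : symmetrize n F =
    ∑ σ : ∀ i, Equiv.Perm (Fin (n i)), ratRename (permIdx σ).toEmbedding F := by
  simp [symmetrize]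

theorem symmetrize_ratRename (τ : ∀ i, Equiv.Perm (Fin (n i))) (F : RatFun n) :
    symmetrize n (ratRename (permIdx τ).toEmbedding F) = symmetrize n F := by
  rw [symmetrize_apply, symmetrize_apply]
  refine Fintype.sum_equiv (Equiv.mulRight τ) _ _ fun σ => ?_
  rw [ratRename_ratRename]
  rfl

theorem ratRename_symmetrize (τ : ∀ i, Equiv.Perm (Fin (n i))) (F : RatFun n) :
    ratRename (permIdx τ).toEmbedding (symmetrize n F) = symmetrize n F := by
  rw [symmetrize_apply, map_sum]
  refine Fintype.sum_equiv (Equiv.mulLeft τ) _ _ fun σ => ?_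
  rw [ratRename_ratRename]
  rfl

theorem symmetrize_of_invariant {F : RatFun n}
    (h : ∀ σ : ∀ i, Equiv.Perm (Fin (n i)), ratRename (permIdx σ).toEmbedding F = F) :
    symmetrize n F = (∏ i, ((n i).factorial : ParamField I)) • F := by
  rw [symmetrize_apply, Finset.sum_congr rfl fun σ _ => h σ, Finset.sum_const, Finset.card_univ,
    Fintype.card_pi]
  simp only [Fintype.card_perm, Fintype.card_fin]
  rw [← Nat.cast_smul_eq_nsmul (ParamField I), Nat.cast_prod]

theorem symmetrize_of_le_one (h : ∀ i, n i ≤ 1) (F : RatFun n) : symmetrize n F = F := by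
  rw [symmetrize_of_invariant, Finset.prod_eq_one, one_smul]
  · intro i _
    rw [Nat.factorial_eq_one.2 (h i), Nat.cast_one]
  · intro σ
    refine ratRename_eq_self ?_ F
    rintro ⟨i, a⟩
    have : Subsingleton (Fin (n i)) := Fin.subsingleton_iff_le_one.2 (h i)
    exact Sigma.ext rfl (heq_of_eq (this.elim _ _))

variable [∀ i j : I, Fintype (i ⟶ j)]

theorem map_zeta' {K L : Type*} [Field K] [Field L] [Algebra (ParamField I) K]
    [Algebra (ParamField I) L] (φ : K →ₐ[ParamField I] L) (i j : I) (x : K) :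
    φ (zeta' i j x) = zeta' i j (φ x) := by
  simp only [zeta', map_mul, map_prod, map_sub, map_div₀, map_one, AlgHom.commutes]
  congr 2
  split_ifs <;> simp

/-- The product of `ζ'` over all pairs of variables, the first of which precedes the second one
in the list. -/
noncomputable def listZeta : List (VarIdx n) → RatFun n
  | [] => 1
  | x :: l => listZeta l * (l.map fun y : VarIdx n => zeta' x.1 y.1 ((z x : RatFun n) / z y)).prod

theorem listZeta_append (l l' : List (VarIdx n)) :
    listZeta (l ++ l') = listZeta l * listZeta l' *
      (l.map fun x : VarIdx n =>
        (l'.map fun y : VarIdx n => zeta' x.1 y.1 ((z x : RatFun n) / z y)).prod).prod := by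
  induction l with
  | nil => simp [listZeta]
  | cons x l ih =>
    simp only [List.cons_append, listZeta, ih, List.map_append, List.prod_append, List.map_cons,
      List.prod_cons]
    ring

theorem ratRename_listZeta (f : VarIdx n ↪ VarIdx m) (hf : ∀ x, (f x).1 = x.1)
    (l : List (VarIdx n)) : ratRename f (listZeta l) = listZeta (l.map f) := by
  induction l with
  | nil => simp [listZeta]
  | cons x l ih =>
    simp only [listZeta, List.map_cons, map_mul, ih, map_list_prod, List.map_map]
    congr 2
    apply List.map_congr_left
    intro y _
    simp only [Function.comp_apply, map_zeta', map_div₀, ratRename_z, hf]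

/-- The list contains every variable exactly once. -/
def IsOrdering (l : List (VarIdx n)) : Prop := l.Nodup ∧ ∀ x, x ∈ l

theorem IsOrdering.prod_eq {M : Type*} [CommMonoid M] {l : List (VarIdx n)} (hl : IsOrdering l)
    (g : VarIdx n → M) : (l.map g).prod = ∏ x, g x := by
  rw [← List.prod_toFinset g hl.1]
  congr 1
  ext x
  simp [hl.2 x]

theorem IsOrdering.map_equiv {l : List (VarIdx n)} (hl : IsOrdering l) (f : VarIdx n ≃ VarIdx n) :
    IsOrdering (l.map f.toEmbedding) := by
  refine ⟨hl.1.map f.injective, fun x => ?_⟩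
  rw [List.mem_map]
  exact ⟨f.symm x, hl.2 _, by simp⟩

theorem idxLeft_or_idxRight (x : VarIdx (n + m)) :
    (∃ y, idxLeft n m y = x) ∨ ∃ y, idxRight n m y = x := by
  obtain ⟨i, a⟩ := x
  change Fin (n i + m i) at a
  refine Fin.addCases (fun b => Or.inl ⟨⟨i, b⟩, rfl⟩) (fun b => Or.inr ⟨⟨i, b⟩, rfl⟩) a

theorem idxLeft_ne_idxRight (x : VarIdx n) (y : VarIdx m) : idxLeft n m x ≠ idxRight n m y := by
  obtain ⟨i, a⟩ := x
  obtain ⟨j, b⟩ := y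
  intro h
  obtain ⟨rfl, h⟩ := Sigma.mk.inj_iff.1 h
  have h1 := congrArg Fin.val (eq_of_heq h)
  simp at h1
  have := a.2
  omega

theorem IsOrdering.append {l : List (VarIdx n)} {l' : List (VarIdx m)} (hl : IsOrdering l)
    (hl' : IsOrdering l') : IsOrdering (l.map (idxLeft n m) ++ l'.map (idxRight n m)) := by
  refine ⟨?_, fun x => ?_⟩
  · rw [List.nodup_append]
    refine ⟨hl.1.map (idxLeft n m).injective, hl'.1.map (idxRight n m).injective, ?_⟩
    intro a ha b hb
    obtain ⟨x, -, rfl⟩ := List.mem_map.1 ha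
    obtain ⟨y, -, rfl⟩ := List.mem_map.1 hb
    exact idxLeft_ne_idxRight x y
  · rw [List.mem_append, List.mem_map, List.mem_map]
    rcases idxLeft_or_idxRight x with ⟨y, rfl⟩ | ⟨y, rfl⟩
    · exact Or.inl ⟨y, hl.2 y, rfl⟩
    · exact Or.inr ⟨y, hl'.2 y, rfl⟩

/-- The permutation of `z_{i1}, …, z_{i,n_i+m_i}` acting by `σ` and `τ` on the two blocks. -/
def blockPerm (σ : ∀ i, Equiv.Perm (Fin (n i))) (τ : ∀ i, Equiv.Perm (Fin (m i))) :
    ∀ i, Equiv.Perm (Fin ((n + m) i)) :=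
  fun i => (finSumFinEquiv.permCongr (Equiv.Perm.sumCongr (σ i) (τ i)) : Equiv.Perm (Fin (n i + m i)))

theorem blockPerm_idxLeft (σ : ∀ i, Equiv.Perm (Fin (n i))) (τ : ∀ i, Equiv.Perm (Fin (m i)))
    (x : VarIdx n) : permIdx (blockPerm σ τ) (idxLeft n m x) = idxLeft n m (permIdx σ x) := by
  obtain ⟨i, a⟩ := x
  refine Sigma.ext rfl (heq_of_eq ?_)
  change finSumFinEquiv (Equiv.Perm.sumCongr (σ i) (τ i) (finSumFinEquiv.symm (Fin.castAdd _ a))) = _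
  simp only [Equiv.Perm.sumCongr_apply, finSumFinEquiv_symm_apply_castAdd, Sum.map_inl,
    finSumFinEquiv_apply_left]
  rfl

theorem blockPerm_idxRight (σ : ∀ i, Equiv.Perm (Fin (n i))) (τ : ∀ i, Equiv.Perm (Fin (m i)))
    (x : VarIdx m) : permIdx (blockPerm σ τ) (idxRight n m x) = idxRight n m (permIdx τ x) := by
  obtain ⟨i, a⟩ := x
  refine Sigma.ext rfl (heq_of_eq ?_)
  change finSumFinEquiv (Equiv.Perm.sumCongr (σ i) (τ i) (finSumFinEquiv.symm (Fin.natAdd _ a))) = _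
  simp only [Equiv.Perm.sumCongr_apply, finSumFinEquiv_symm_apply_natAdd, Sum.map_inr,
    finSumFinEquiv_apply_right]
  rfl

/-- The shuffle product of two symmetrizations needs only one symmetrization. -/
theorem shuffleMul_symmetrize (F : RatFun n) (F' : RatFun m) :
    shuffleMul (symmetrize n F) (symmetrize m F') =
      symmetrize (n + m) (ratRename (idxLeft n m) F * ratRename (idxRight n m) F' *
        ∏ x : VarIdx n, ∏ y : VarIdx m,
          zeta' x.1 y.1 ((z (idxLeft n m x) : RatFun (n + m)) / z (idxRight n m y))) := by
  set Z : RatFun (n + m) := ∏ x : VarIdx n, ∏ y : VarIdx m,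
    zeta' x.1 y.1 ((z (idxLeft n m x) : RatFun (n + m)) / z (idxRight n m y)) with hZ
  -- Permutations of the two blocks preserve the cross factor and are absorbed by the outer
  -- symmetrization. All ∏ n_i! ∏ m_i! terms thus agree, which cancels the normalization.
  have key : ∀ σ τ, symmetrize (n + m)
      (ratRename (idxLeft n m) (ratRename (permIdx σ).toEmbedding F) *
        ratRename (idxRight n m) (ratRename (permIdx τ).toEmbedding F') * Z) =
      symmetrize (n + m) (ratRename (idxLeft n m) F * ratRename (idxRight n m) F' * Z) := by
    intro σ τ
    rw [← symmetrize_ratRename (blockPerm σ τ)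
      (ratRename (idxLeft n m) F * ratRename (idxRight n m) F' * Z)]
    congr 1
    simp only [map_mul, ratRename_ratRename]
    congr 2
    · congr 2
      ext x : 1
      exact (blockPerm_idxLeft σ τ x).symm
    · congr 2
      ext x : 1
      exact (blockPerm_idxRight σ τ x).symm
    · rw [hZ]
      simp only [map_prod, map_zeta', map_div₀, ratRename_z, Equiv.coe_toEmbedding,
        blockPerm_idxLeft, blockPerm_idxRight]
      refine (Fintype.prod_equiv (permIdx σ) _ _ fun x => ?_).symm
      exact Fintype.prod_equiv (permIdx τ) _ _ fun y => rfl
  rw [shuffleMul, symmetrize_apply F, symmetrize_apply F', map_sum, map_sum, Finset.sum_mul_sum,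
    Finset.sum_mul, map_smul, map_sum]
  simp only [Finset.sum_mul, map_sum]
  rw [Finset.sum_congr rfl fun σ _ => Finset.sum_congr rfl fun τ _ => key σ τ]
  simp only [Finset.sum_const, Finset.card_univ, Fintype.card_pi, Fintype.card_perm,
    Fintype.card_fin]
  rw [← Nat.cast_smul_eq_nsmul (ParamField I), ← Nat.cast_smul_eq_nsmul (ParamField I), smul_smul,
    smul_smul, Nat.cast_prod, Nat.cast_prod, mul_assoc, inv_mul_cancel₀, one_smul]
  refine mul_ne_zero ?_ ?_ <;>
    exact Finset.prod_ne_zero_iff.2 fun i _ => Nat.cast_ne_zero.2 (Nat.factorial_ne_zero _)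

/-- The cross factors of the shuffle product are precisely what is missing between the concatenated
orderings. -/
theorem shuffleMul_symmetrize_listZeta {l : List (VarIdx n)} {l' : List (VarIdx m)}
    (hl : IsOrdering l) (hl' : IsOrdering l') (f : RatFun n) (f' : RatFun m) :
    shuffleMul (symmetrize n (f * listZeta l)) (symmetrize m (f' * listZeta l')) =
      symmetrize (n + m) (ratRename (idxLeft n m) f * ratRename (idxRight n m) f' *
        listZeta (l.map (idxLeft n m) ++ l'.map (idxRight n m))) := by
  rw [shuffleMul_symmetrize, listZeta_append, map_mul (ratRename (idxLeft n m)),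
    map_mul (ratRename (idxRight n m)), ratRename_listZeta _ (fun _ => rfl), ratRename_listZeta _ (fun _ => rfl), List.map_map,
    ← hl.prod_eq]
  congr 1
  have : ((fun x : VarIdx (n + m) => ((l'.map (idxRight n m)).map fun y : VarIdx (n + m) =>
      zeta' x.1 y.1 ((z x : RatFun (n + m)) / z y)).prod) ∘ idxLeft n m) =
      fun x => ∏ y : VarIdx m,
        zeta' x.1 y.1 ((z (idxLeft n m x) : RatFun (n + m)) / z (idxRight n m y)) := by
    funext x
    rw [← hl'.prod_eq, Function.comp_apply, List.map_map]
    rfl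
  rw [this]
  ring

end Words

/-! ### Elements satisfying the wheel conditions are combinations of words. -/

section WordSpace

variable {I : Type u} [Quiver.{v} I] [Fintype I] {n m : I → ℕ}

/-- A rational function that is invertible in the ring of Laurent polynomials. -/
def IsLaurentUnit (u : RatFun n) : Prop :=
  u ≠ 0 ∧ u ∈ laurentRange n ∧ u⁻¹ ∈ laurentRange n

theorem isLaurentUnit_one : IsLaurentUnit (1 : RatFun n) :=
  ⟨one_ne_zero, one_mem _, by rw [inv_one]; exact one_mem _⟩

theorem IsLaurentUnit.mul {u u' : RatFun n} (h : IsLaurentUnit u) (h' : IsLaurentUnit u') :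
    IsLaurentUnit (u * u') :=
  ⟨mul_ne_zero h.1 h'.1, mul_mem h.2.1 h'.2.1, by rw [mul_inv]; exact mul_mem h.2.2 h'.2.2⟩

theorem IsLaurentUnit.inv {u : RatFun n} (h : IsLaurentUnit u) : IsLaurentUnit u⁻¹ :=
  ⟨inv_ne_zero h.1, h.2.2, by rw [inv_inv]; exact h.2.1⟩

theorem isLaurentUnit_z (x : VarIdx n) : IsLaurentUnit (z x : RatFun n) :=
  ⟨(z x).ne_zero, by simpa using z_zpow_mem_laurentRange x 1,
    by simpa using z_zpow_mem_laurentRange x (-1)⟩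

theorem isLaurentUnit_algebraMap {a : ParamField I} (ha : a ≠ 0) :
    IsLaurentUnit (algebraMap (ParamField I) (RatFun n) a) :=
  ⟨(map_ne_zero _).2 ha, Subalgebra.algebraMap_mem _ a,
    by rw [← map_inv₀]; exact Subalgebra.algebraMap_mem _ _⟩

theorem isLaurentUnit_toRat_unit (u : (MvPolynomial (VarIdx n) (ParamField I))ˣ) :
    IsLaurentUnit (toRat n (u : MvPolynomial (VarIdx n) (ParamField I))) := by
  refine ⟨toRat_ne_zero u.ne_zero, toRat_mem_laurentRange _, ?_⟩
  have : (toRat n (u : MvPolynomial (VarIdx n) (ParamField I)))⁻¹ =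
      toRat n ((u⁻¹ : (MvPolynomial (VarIdx n) (ParamField I))ˣ) : MvPolynomial _ _) := by
    apply inv_eq_of_mul_eq_one_right
    rw [← map_mul, Units.mul_inv, map_one]
  rw [this]
  exact toRat_mem_laurentRange _

theorem exists_isLaurentUnit_prod {ι : Type*} (s : Finset ι) (f g : ι → RatFun n)
    (h : ∀ i ∈ s, ∃ u, IsLaurentUnit u ∧ f i = u * g i) :
    ∃ u, IsLaurentUnit u ∧ ∏ i ∈ s, f i = u * ∏ i ∈ s, g i := by
  classical
  induction s using Finset.induction_on with
  | empty => exact ⟨1, isLaurentUnit_one, by simp⟩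
  | insert a s ha ih =>
    obtain ⟨u, hu, h1⟩ := ih fun i hi => h i (Finset.mem_insert_of_mem hi)
    obtain ⟨u', hu', h2⟩ := h a (Finset.mem_insert_self a s)
    refine ⟨u' * u, hu'.mul hu, ?_⟩
    rw [Finset.prod_insert ha, Finset.prod_insert ha, h1, h2]
    ring

theorem exists_isLaurentUnit_list_prod {ι : Type*} (s : List ι) (f g : ι → RatFun n)
    (h : ∀ i ∈ s, ∃ u, IsLaurentUnit u ∧ f i = u * g i) :
    ∃ u, IsLaurentUnit u ∧ (s.map f).prod = u * (s.map g).prod := by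
  induction s with
  | nil => exact ⟨1, isLaurentUnit_one, by simp⟩
  | cons a s ih =>
    obtain ⟨u, hu, h1⟩ := ih fun i hi => h i (List.mem_cons_of_mem _ hi)
    obtain ⟨u', hu', h2⟩ := h a List.mem_cons_self
    refine ⟨u' * u, hu'.mul hu, ?_⟩
    rw [List.map_cons, List.prod_cons, List.map_cons, List.prod_cons, h1, h2]
    ring

variable [DecidableEq I] [∀ i j : I, Fintype (i ⟶ j)]

theorem toRat_linForm (u : (ParamField I)ˣ) (y x : VarIdx n) :
    toRat n (linForm u y x) = z x - algebraMap _ _ (u : ParamField I) * z y := by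
  rw [linForm, map_sub, map_mul, toRat_X, toRat_X, toRat_C]

/-- Factor by factor: the color difference y - x cancels the pole and leaves y - x / q; 1 / t - x /
y is (t y)⁻¹ (y - t x); and 1 - t y / (q x) is -(t / q) x⁻¹ (y - (q / t) x). -/
theorem exists_zeta'_mul_colorDiff {x y : VarIdx n} (hxy : x ≠ y) :
    ∃ u, IsLaurentUnit u ∧
      zeta' x.1 y.1 ((z x : RatFun n) / z y) * toRat n (colorDiff Sigma.fst x y) =
        u * toRat n (penalty Sigma.fst x y) := by
  have hx := (z x).ne_zero
  have hy := (z y).ne_zero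
  have hyx : (z y : RatFun n) - z x ≠ 0 := sub_ne_zero.2 fun h => hxy (z_injective h).symm
  have hq : algebraMap (ParamField I) (RatFun n) (q I) ≠ 0 := (map_ne_zero _).2 (q I).ne_zero
  have ht : ∀ {i j : I} (e : i ⟶ j), algebraMap (ParamField I) (RatFun n) (t e) ≠ 0 :=
    fun e => (map_ne_zero _).2 (t e).ne_zero
  have h1 : ∃ u, IsLaurentUnit u ∧ (if x.1 = y.1 then
      (1 - (z x : RatFun n) / z y * (algebraMap (ParamField I) (RatFun n) (q I))⁻¹) /
        (1 - (z x : RatFun n) / z y) else 1) * toRat n (colorDiff Sigma.fst x y) =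
      u * toRat n (if x.1 = y.1 then linForm (q I)⁻¹ x y else 1) := by
    refine ⟨1, isLaurentUnit_one, ?_⟩
    unfold colorDiff
    split_ifs
    · rw [toRat_linForm, map_sub, toRat_X, toRat_X, Units.val_inv_eq_inv_val, map_inv₀]
      have : (1 : RatFun n) - (z x : RatFun n) / z y ≠ 0 := by
        rw [ne_eq, sub_eq_zero, eq_div_iff hy, one_mul]
        exact sub_ne_zero.1 hyx
      field_simp
    · simp
  obtain ⟨u1, hu1, h1⟩ := h1
  obtain ⟨u2, hu2, h2⟩ := exists_isLaurentUnit_prod (n := n) (Finset.univ : Finset (x.1 ⟶ y.1))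
    (fun e => 1 / algebraMap (ParamField I) (RatFun n) (t e) - (z x : RatFun n) / z y)
    (fun e => toRat n (linForm (ratio (Sum.inl e : EdgeBetween x.1 y.1)) x y)) (by
      intro e _
      refine ⟨(algebraMap (ParamField I) (RatFun n) (t e))⁻¹ * (z y : RatFun n)⁻¹,
        (isLaurentUnit_algebraMap (t e).ne_zero).inv.mul (isLaurentUnit_z y).inv, ?_⟩
      rw [toRat_linForm]
      have := ht e
      simp only [ratio, Sum.elim_inl]
      field_simp)
  obtain ⟨u3, hu3, h3⟩ := exists_isLaurentUnit_prod (n := n) (Finset.univ : Finset (y.1 ⟶ x.1))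
    (fun e => 1 - algebraMap (ParamField I) (RatFun n) (t e) /
      (algebraMap (ParamField I) (RatFun n) (q I) * ((z x : RatFun n) / z y)))
    (fun e => toRat n (linForm (ratio (Sum.inr e : EdgeBetween x.1 y.1)) x y)) (by
      intro e _
      refine ⟨algebraMap (ParamField I) (RatFun n) (-(t e : ParamField I) / q I) *
        (z x : RatFun n)⁻¹, (isLaurentUnit_algebraMap
          (div_ne_zero (neg_ne_zero.2 (t e).ne_zero) (q I).ne_zero)).mul
          (isLaurentUnit_z x).inv, ?_⟩
      rw [toRat_linForm]
      have := ht e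
      simp only [ratio, Sum.elim_inr, map_div₀, map_neg, Units.val_div_eq_div_val]
      field_simp
      ring)
  refine ⟨u1 * u2 * u3, (hu1.mul hu2).mul hu3, ?_⟩
  rw [penalty, map_mul, map_prod, Fintype.prod_sum_type, zeta', h2, h3]
  linear_combination (u2 * (∏ e : x.1 ⟶ y.1,
    toRat n (linForm (ratio (Sum.inl e : EdgeBetween x.1 y.1)) x y)) * u3 * ∏ e : y.1 ⟶ x.1,
    toRat n (linForm (ratio (Sum.inr e : EdgeBetween x.1 y.1)) x y)) * h1

theorem exists_listZeta_mul_vandermonde {l : List (VarIdx n)} (hl : l.Nodup) :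
    ∃ u, IsLaurentUnit u ∧ listZeta l * toRat n (vandermonde Sigma.fst l) =
      u * toRat n (listPenalty Sigma.fst l) := by
  induction l with
  | nil => exact ⟨1, isLaurentUnit_one, by simp [listZeta, vandermonde, listPenalty]⟩
  | cons x l ih =>
    rw [List.nodup_cons] at hl
    obtain ⟨u, hu, h⟩ := ih hl.2
    obtain ⟨u', hu', h'⟩ := exists_isLaurentUnit_list_prod (n := n) l
      (fun y => zeta' x.1 y.1 ((z x : RatFun n) / z y) * toRat n (colorDiff Sigma.fst x y))
      (fun y => toRat n (penalty Sigma.fst x y))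
      fun y hy => exists_zeta'_mul_colorDiff (by rintro rfl; exact hl.1 hy)
    refine ⟨u * u', hu.mul hu', ?_⟩
    rw [List.prod_map_mul] at h'
    simp only [listZeta, vandermonde, listPenalty, map_mul, map_list_prod, List.map_map]
    change (_ * _) * (_ * (l.map fun y => toRat n (colorDiff Sigma.fst x y)).prod) =
      _ * _ * (_ * (l.map fun y => toRat n (penalty Sigma.fst x y)).prod)
    linear_combination (l.map fun y : VarIdx n => zeta' x.1 y.1 ((z x : RatFun n) / z y)).prod *
      (l.map fun y => toRat n (colorDiff Sigma.fst x y)).prod * h +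
      u * toRat n (listPenalty Sigma.fst l) * h'

theorem vandermonde_ne_zero {l : List (VarIdx n)} (hl : l.Nodup) :
    vandermonde (Sigma.fst : VarIdx n → I) l ≠ 0 := by
  induction l with
  | nil => simp [vandermonde]
  | cons x l ih =>
    rw [List.nodup_cons] at hl
    refine mul_ne_zero (ih hl.2) (List.prod_ne_zero ?_)
    rw [List.mem_map]
    rintro ⟨y, hy, h⟩
    unfold colorDiff at h
    split_ifs at h
    · rw [sub_eq_zero] at h
      exact hl.1 (MvPolynomial.X_injective h ▸ hy)
    · exact one_ne_zero h

/-- The span of the symmetrizations of Laurent polynomials times products of functions `ζ'`. -/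
noncomputable def wordSpace (n : I → ℕ) : Submodule (ParamField I) (RatFun n) :=
  Submodule.span _ {F | ∃ f ∈ laurentRange n, ∃ l : List (VarIdx n), IsOrdering l ∧
    F = symmetrize n (f * listZeta l)}

/-- For F = P_l the quotient by V is a Laurent unit times the ζ'-product of l; ideal coefficients
are absorbed into f. -/
theorem symmetrize_mem_wordSpace {F : MvPolynomial (VarIdx n) (ParamField I)}
    (hF : F ∈ orderIdeal (Sigma.fst : VarIdx n → I) Finset.univ) {f : RatFun n}
    (hf : f ∈ laurentRange n) :
    symmetrize n (f * (toRat n F / toRat n (vandermonde Sigma.fst Finset.univ.toList))) ∈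
      wordSpace n := by
  induction hF using Submodule.span_induction generalizing f with
  | zero => simp
  | add F F' _ _ h h' =>
    rw [map_add, add_div, mul_add, map_add]
    exact add_mem (h hf) (h' hf)
  | smul a F _ h =>
    rw [smul_eq_mul, map_mul (toRat n), mul_div_assoc, ← mul_assoc]
    exact h (mul_mem hf (toRat_mem_laurentRange a))
  | mem P hP =>
    obtain ⟨l, hl, hl', rfl⟩ := hP
    obtain ⟨u, hu, h⟩ := exists_listZeta_mul_vandermonde hl
    have hperm : l.Perm Finset.univ.toList :=
      (List.perm_ext_iff_of_nodup hl (Finset.nodup_toList _)).2 fun a => by simp [hl']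
    obtain ⟨v, hv⟩ := vandermonde_perm (Sigma.fst : VarIdx n → I) hperm
    have hv' := isLaurentUnit_toRat_unit v
    apply Submodule.subset_span
    refine ⟨f * (u⁻¹ * (toRat n v)⁻¹), mul_mem hf (mul_mem hu.2.2 hv'.2.2), l,
      ⟨hl, fun x => (hl' x).2 (Finset.mem_univ x)⟩, ?_⟩
    congr 1
    rw [← hv, map_mul]
    have h1 := toRat_ne_zero (vandermonde_ne_zero hl)
    have h2 := hu.1
    have h3 := hv'.1
    field_simp
    linear_combination -f * h

/-- After cancelling V and the monomials, symmetrizing the symmetric R only multiplies it by ∏ n_i!,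
which is invertible in characteristic zero. -/
theorem subst_mem_wordSpace {R : Laurent n} (hR : R ∈ shuffleSpace n) :
    subst z R ∈ wordSpace n := by
  obtain ⟨N, f, hf⟩ := exists_aeval_eq_subst_mul R
  obtain ⟨M, hM⟩ := exists_pow_mul_mem_orderIdeal f ((wheel_iff hf).1 hR.2)
  have h1 := hf z
  rw [← toRat_eq_aeval] at h1
  have hZ : IsLaurentUnit (∏ x : VarIdx n, (z x : RatFun n)) := by
    obtain ⟨u, hu, h⟩ := exists_isLaurentUnit_prod (Finset.univ : Finset (VarIdx n))
      (fun x => (z x : RatFun n)) 1 fun x _ => ⟨z x, isLaurentUnit_z x, by simp⟩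
    rw [h]
    simpa using hu
  have hpow : ∀ k : ℕ, ((∏ x : VarIdx n, (z x : RatFun n)) ^ k)⁻¹ ∈ laurentRange n := by
    intro k
    rw [← inv_pow]
    exact pow_mem hZ.2.2 k
  have h2 := symmetrize_mem_wordSpace hM (mul_mem (hpow N) (hpow M))
  have hV := toRat_ne_zero (vandermonde_ne_zero (Finset.nodup_toList (Finset.univ : Finset (VarIdx n))))
  have h3 : ((∏ x : VarIdx n, (z x : RatFun n)) ^ N)⁻¹ * ((∏ x : VarIdx n, (z x : RatFun n)) ^ M)⁻¹ *
      (toRat n ((∏ x, MvPolynomial.X x) ^ M * (f * vandermonde Sigma.fst Finset.univ.toList)) /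
        toRat n (vandermonde Sigma.fst Finset.univ.toList)) = subst z R := by
    rw [map_mul, map_mul, map_pow, map_prod, h1, Finset.prod_pow]
    simp only [toRat_X]
    have := hZ.1
    field_simp
  rw [h3, symmetrize_of_invariant] at h2
  · rwa [Submodule.smul_mem_iff] at h2
    exact Finset.prod_ne_zero_iff.2 fun i _ => Nat.cast_ne_zero.2 (Nat.factorial_ne_zero _)
  · intro σ
    rw [ratRename_subst_z]
    exact hR.1 σ

end WordSpace

/-! ### Words satisfy the wheel conditions; divisibility by Vandermonde products. -/

section WheelOfWords

variable {I : Type u} [Quiver.{v} I] [DecidableEq I] [∀ i j : I, Fintype (i ⟶ j)]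
  {X : Type*} [DecidableEq X] {c : X → I}

local notation "𝒜" => MvPolynomial X (ParamField I)

theorem penalty_dvd_listPenalty {x y : X} {l : List X} (hy : y ∈ l) :
    penalty c x y ∣ listPenalty c (x :: l) :=
  (List.dvd_prod (List.mem_map_of_mem hy)).trans (Dvd.intro_left _ rfl)

/-- In the cycle x → w → y → x, whichever variable comes first in the list precedes its successor.
-/
theorem exists_penalty_dvd {x y w : X} (hxy : x ≠ y) (hxw : x ≠ w) (hyw : y ≠ w) {l : List X}
    (hx : x ∈ l) (hy : y ∈ l) (hw : w ∈ l) : penalty c x w ∣ listPenalty c l ∨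
      penalty c y x ∣ listPenalty c l ∨ penalty c w y ∣ listPenalty c l := by
  induction l with
  | nil => exact absurd hx List.not_mem_nil
  | cons v l ih =>
    rw [List.mem_cons] at hx hy hw
    by_cases h1 : v = x
    · subst h1
      exact Or.inl (penalty_dvd_listPenalty (hw.resolve_left hxw.symm))
    by_cases h2 : v = y
    · subst h2
      exact Or.inr (Or.inl (penalty_dvd_listPenalty (hx.resolve_left hxy)))
    by_cases h3 : v = w
    · subst h3
      exact Or.inr (Or.inr (penalty_dvd_listPenalty (hy.resolve_left hyw)))
    have h4 : listPenalty c l ∣ listPenalty c (v :: l) := Dvd.intro _ rfl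
    rcases ih (hx.resolve_left (Ne.symm h1)) (hy.resolve_left (Ne.symm h2))
      (hw.resolve_left (Ne.symm h3)) with h | h | h
    · exact Or.inl (h.trans h4)
    · exact Or.inr (Or.inl (h.trans h4))
    · exact Or.inr (Or.inr (h.trans h4))

theorem wheelSub_linForm (x y w a b : X) (u u' : (ParamField I)ˣ) :
    wheelSub x y w u (linForm u' a b) = wheelSub x y w u (MvPolynomial.X b) -
      MvPolynomial.C (u' : ParamField I) * wheelSub x y w u (MvPolynomial.X a) := by
  rw [linForm, map_sub, map_mul, ← MvPolynomial.algebraMap_eq, AlgHom.commutes]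

/-- Every ordering of the variables violates one of the relations of a wheel. -/
theorem wheelOn_listPenalty {s : Finset X} {l : List X} (h : ∀ x ∈ s, x ∈ l) :
    WheelOn c s (listPenalty c l) := by
  intro x hx y hy w hw hxw hxy hyw hc e
  have e1 : wheelSub x y w (ratio e) (MvPolynomial.X x) =
      MvPolynomial.C (q I : ParamField I) * MvPolynomial.X w := by simp [wheelSub]
  have e2 : wheelSub x y w (ratio e) (MvPolynomial.X y) =
      MvPolynomial.C ((q I / ratio e : (ParamField I)ˣ) : ParamField I) * MvPolynomial.X w := by
    simp [wheelSub, hxy.symm]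
  have e3 : wheelSub x y w (ratio e) (MvPolynomial.X w) = MvPolynomial.X w :=
    wheelSub_X_of_ne hxw.symm hyw.symm _
  have hz : ∀ {P : 𝒜}, wheelSub x y w (ratio e) P = 0 → P ∣ listPenalty c l →
      wheelSub x y w (ratio e) (listPenalty c l) = 0 := by
    rintro P hP ⟨a, ha⟩
    rw [ha, map_mul, hP, zero_mul]
  rcases exists_penalty_dvd (c := c) hxy hxw hyw (h x hx) (h y hy) (h w hw) with hd | hd | hd
  · refine hz ?_ hd
    rw [penalty, if_pos hc, map_mul, wheelSub_linForm, e1, e3, ← mul_assoc, ← map_mul,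
      Units.inv_mul, map_one, one_mul, sub_self, zero_mul]
  · refine hz ?_ hd
    rw [penalty, map_mul, map_prod]
    refine mul_eq_zero_of_right _ (Finset.prod_eq_zero (Finset.mem_univ e) ?_)
    rw [wheelSub_linForm, e1, e2, ← mul_assoc, ← map_mul, ← Units.val_mul, mul_div_cancel,
      sub_self]
  · refine hz ?_ hd
    rw [penalty, map_mul, map_prod]
    -- The relation y = (q / u) w belongs to the reversed edge, because w and x have the same color.
    have he : ∃ e' : EdgeBetween (c w) (c y), ratio e' = q I / ratio e := by
      rw [← hc]
      exact ⟨e.swap, ratio_swap e⟩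
    obtain ⟨e', he'⟩ := he
    refine mul_eq_zero_of_right _ (Finset.prod_eq_zero (Finset.mem_univ e') ?_)
    rw [wheelSub_linForm, e2, e3, he', sub_self]

theorem replace_vandermonde {x : X} (a : 𝒜) {l : List X} (hx : x ∉ l) :
    replace x a (vandermonde c l) = vandermonde c l := by
  have h1 : ∀ y z, y ≠ x → z ≠ x → replace x a (colorDiff c y z) = colorDiff c y z := by
    intro y z hy hz
    unfold colorDiff
    split_ifs
    · rw [map_sub, replace_X_of_ne hy, replace_X_of_ne hz]
    · simp
  induction l with
  | nil => simp [vandermonde]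
  | cons y l ih =>
    rw [List.mem_cons, not_or] at hx
    rw [vandermonde, map_mul, map_list_prod, List.map_map, ih hx.2]
    congr 2
    apply List.map_congr_left
    intro z hz
    exact h1 y z (Ne.symm hx.1) (by rintro rfl; exact hx.2 hz)

/-- By induction on the list: the Vandermonde product of the tail does not involve x, so after
dividing by it the quotient still vanishes at x = y for each y of the same color, and these roots
are distinct. -/
theorem vandermonde_dvd {l : List X} (hl : l.Nodup) (hV : vandermonde c l ≠ 0) {Q : 𝒜}
    (h : ∀ x ∈ l, ∀ y ∈ l, x ≠ y → c x = c y → replace x (MvPolynomial.X y) Q = 0) :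
    vandermonde c l ∣ Q := by
  induction l with
  | nil => simp [vandermonde]
  | cons x l ih =>
    rw [List.nodup_cons] at hl
    rw [vandermonde] at hV
    obtain ⟨Q', rfl⟩ := ih hl.2 (left_ne_zero_of_mul hV) fun a ha b hb =>
      h a (List.mem_cons_of_mem _ ha) b (List.mem_cons_of_mem _ hb)
    refine mul_dvd_mul_left _ ?_
    have h1 := prod_X_sub_dvd x (l.toFinset.filter fun y => c x = c y) MvPolynomial.X
      MvPolynomial.X_injective.injOn Q' ?_
    · refine dvd_trans ?_ h1
      rw [← List.prod_toFinset _ hl.2, Finset.prod_filter]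
      refine Finset.prod_dvd_prod_of_dvd _ _ fun y _ => ?_
      unfold colorDiff
      split_ifs
      · exact (dvd_neg.2 dvd_rfl).trans (dvd_of_eq (neg_sub _ _))
      · exact dvd_rfl
    · intro y hy
      rw [Finset.mem_filter, List.mem_toFinset] at hy
      have h2 := h x List.mem_cons_self y (List.mem_cons_of_mem _ hy.1)
        (by rintro rfl; exact hl.1 hy.1) hy.2
      rw [map_mul, replace_vandermonde _ hl.1] at h2
      exact (mul_eq_zero.1 h2).resolve_left (left_ne_zero_of_mul hV)

theorem rename_vandermonde {Y : Type*} [DecidableEq Y] {c' : Y → I} (f : X ↪ Y)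
    (hf : ∀ x, c' (f x) = c x) (l : List X) :
    MvPolynomial.rename f (vandermonde c l) = vandermonde c' (l.map f) := by
  induction l with
  | nil => simp [vandermonde]
  | cons x l ih =>
    simp only [vandermonde, List.map_cons, map_mul, ih, map_list_prod, List.map_map]
    congr 2
    apply List.map_congr_left
    intro y _
    simp only [Function.comp_apply, colorDiff, hf]
    split_ifs <;> simp

theorem rename_listPenalty {Y : Type*} [DecidableEq Y] {c' : Y → I} (f : X ↪ Y)
    (hf : ∀ x, c' (f x) = c x) (l : List X) :
    MvPolynomial.rename f (listPenalty c l) = listPenalty c' (l.map f) := by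
  have h1 : ∀ (u : (ParamField I)ˣ) (y x : X),
      MvPolynomial.rename f (linForm u y x : 𝒜) = linForm u (f y) (f x) := by
    intro u y x
    simp [linForm]
  induction l with
  | nil => simp [listPenalty]
  | cons x l ih =>
    simp only [listPenalty, List.map_cons, map_mul, ih, map_list_prod, List.map_map]
    congr 2
    apply List.map_congr_left
    intro y _
    simp only [Function.comp_apply, penalty, map_mul, map_prod, h1, hf]
    congr 1
    · split_ifs <;> simp [h1]
    · have h2 : ∀ {i j i' j' : I}, i = i' → j = j' → ∀ g : (ParamField I)ˣ → MvPolynomial Y (ParamField I),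
          ∏ e : EdgeBetween i j, g (ratio e) = ∏ e : EdgeBetween i' j', g (ratio e) := by
        rintro i j _ _ rfl rfl g
        rfl
      exact h2 (hf x).symm (hf y).symm fun u => linForm u (f x) (f y)

theorem rename_swap_vandermonde {x y : X} (hxy : x ≠ y) (hc : c x = c y) {l : List X}
    (hx : x ∉ l) (hy : y ∉ l) :
    MvPolynomial.rename (Equiv.swap x y) (vandermonde c (x :: y :: l)) =
      -vandermonde c (x :: y :: l) := by
  have hc' : ∀ v, c ((Equiv.swap x y).toEmbedding v) = c v := by
    intro v
    rw [Equiv.coe_toEmbedding, Equiv.swap_apply_def]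
    split_ifs with h1 h2
    · rw [h1, hc]
    · rw [h2, hc]
    · rfl
  have h := rename_vandermonde (Equiv.swap x y).toEmbedding hc' (x :: y :: l)
  rw [Equiv.coe_toEmbedding] at h
  rw [h]
  have hl : l.map (Equiv.swap x y) = l := by
    rw [List.map_congr_left (g := id), List.map_id]
    intro v hv
    exact Equiv.swap_apply_of_ne_of_ne (by rintro rfl; exact hx hv) (by rintro rfl; exact hy hv)
  simp only [List.map_cons, Equiv.swap_apply_left, Equiv.swap_apply_right, hl, vandermonde,
    List.prod_cons]
  rw [colorDiff, if_pos hc.symm, colorDiff, if_pos hc]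
  ring

end WheelOfWords

/-! ### Symmetrized words are Laurent polynomials in the shuffle space. -/

section WordsAreShuffles

variable {I : Type u} [Quiver.{v} I] [Fintype I] [DecidableEq I] [∀ i j : I, Fintype (i ⟶ j)]
  {n m : I → ℕ}

theorem exists_permIdx_eq_swap {x y : VarIdx n} (h : x.1 = y.1) :
    ∃ σ : ∀ i, Equiv.Perm (Fin (n i)), permIdx σ = Equiv.swap x y := by
  obtain ⟨i, a⟩ := x
  obtain ⟨j, b⟩ := y
  dsimp only at h
  subst h
  refine ⟨Function.update (fun _ => 1) i (Equiv.swap a b), ?_⟩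
  ext1 ⟨j, d⟩
  change (⟨j, Function.update (fun i => (1 : Equiv.Perm (Fin (n i)))) i (Equiv.swap a b) j d⟩ :
    VarIdx n) = _
  by_cases hj : j = i
  · subst hj
    rw [Function.update_self, Equiv.swap_apply_def, Equiv.swap_apply_def]
    simp only [Sigma.mk.injEq, heq_eq_eq, true_and]
    split_ifs <;> rfl
  · rw [Function.update_of_ne hj, Equiv.swap_apply_of_ne_of_ne]
    · rfl
    · exact fun h => hj (congrArg Sigma.fst h)
    · exact fun h => hj (congrArg Sigma.fst h)

/-- Setting x = y cannot detect the swap, so the value equals its own negative. -/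
theorem replace_eq_zero_of_antisymm {K X : Type*} [Field K] [CharZero K] [DecidableEq X] {x y : X}
    {Q : MvPolynomial X K} (h : MvPolynomial.rename (Equiv.swap x y) Q = -Q) :
    replace x (MvPolynomial.X y) Q = 0 := by
  have h1 : (replace x (MvPolynomial.X y)).comp (MvPolynomial.rename (Equiv.swap x y)) =
      (replace x (MvPolynomial.X y) : MvPolynomial X K →ₐ[K] MvPolynomial X K) := by
    apply MvPolynomial.algHom_ext
    intro v
    rw [AlgHom.comp_apply, MvPolynomial.rename_X, Equiv.swap_apply_def]
    split_ifs with h1 h2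
    · subst h1
      rw [replace_X_self]
      by_cases h2 : y = v
      · subst h2
        rw [replace_X_self]
      · rw [replace_X_of_ne h2]
    · subst h2
      rw [replace_X_self, replace_X_of_ne h1]
    · rfl
  have h2 := congrArg (fun f : MvPolynomial X K →ₐ[K] MvPolynomial X K => f Q) h1
  simp only [AlgHom.comp_apply, h, map_neg] at h2
  exact self_eq_neg.1 h2.symm

/-- Moving x and y to the front of the list costs only a unit; their swap then negates V and fixes
K, so the numerator is antisymmetric and vanishes at x = y. -/
theorem vandermonde_dvd_of_invariant {K : RatFun n} {l : List (VarIdx n)} (hl : l.Nodup)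
    (hK : ∀ σ : ∀ i, Equiv.Perm (Fin (n i)), ratRename (permIdx σ).toEmbedding K = K)
    {Q : MvPolynomial (VarIdx n) (ParamField I)}
    (hQ : K * toRat n (vandermonde Sigma.fst l) = toRat n Q) :
    vandermonde Sigma.fst l ∣ Q := by
  refine vandermonde_dvd hl (vandermonde_ne_zero hl) fun x hx y hy hxy hc => ?_
  have hp : l.Perm (x :: y :: (l.erase x).erase y) :=
    (List.perm_cons_erase hx).trans
      ((List.perm_cons_erase ((List.mem_erase_of_ne hxy.symm).2 hy)).cons x)
  obtain ⟨v, hv⟩ := vandermonde_perm (Sigma.fst : VarIdx n → I) hp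
  have hnd := hp.nodup_iff.1 hl
  rw [List.nodup_cons, List.nodup_cons, List.mem_cons, not_or] at hnd
  have hQ' : K * toRat n (vandermonde Sigma.fst (x :: y :: (l.erase x).erase y)) =
      toRat n (Q * v) := by
    rw [← hv, map_mul, map_mul, ← mul_assoc, hQ]
  obtain ⟨σ, hσ⟩ := exists_permIdx_eq_swap hc
  have h1 := congrArg (ratRename (permIdx σ).toEmbedding) hQ'
  rw [map_mul, hK, ratRename_toRat, ratRename_toRat, hσ, Equiv.coe_toEmbedding,
    rename_swap_vandermonde hxy hc hnd.1.2 hnd.2.1, map_neg, mul_neg, hQ', ← map_neg] at h1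
  have h2 := replace_eq_zero_of_antisymm (toRat_injective h1).symm
  rw [map_mul] at h2
  exact (mul_eq_zero.1 h2).resolve_right (v.isUnit.map _).ne_zero

theorem WheelOn.sum {X : Type*} [DecidableEq X] {c : X → I} {s : Finset X} {ι : Type*}
    {t : Finset ι} {f : ι → MvPolynomial X (ParamField I)} (h : ∀ i ∈ t, WheelOn c s (f i)) :
    WheelOn c s (∑ i ∈ t, f i) := by
  intro x hx y hy w hw hxw hxy hyw hc e
  rw [map_sum]
  exact Finset.sum_eq_zero fun i hi => h i hi x hx y hy w hw hxw hxy hyw hc e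

theorem WheelOn.mul_left {X : Type*} [DecidableEq X] {c : X → I} {s : Finset X}
    {f : MvPolynomial X (ParamField I)} (h : WheelOn c s f)
    (g : MvPolynomial X (ParamField I)) : WheelOn c s (g * f) := by
  intro x hx y hy w hw hxw hxy hyw hc e
  rw [map_mul, h x hx y hy w hw hxw hxy hyw hc e, mul_zero]

/-- The simple poles of the ζ' at equal variables of one color disappear on symmetrization because V
divides the antisymmetric numerator. That numerator is a sum of multiples of P_l for various l and
so vanishes on wheels, where V does not. -/
theorem exists_subst_eq_symmetrize {f : RatFun n} (hf : f ∈ laurentRange n)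
    {l : List (VarIdx n)} (hl : IsOrdering l) :
    ∃ R ∈ shuffleSpace n, subst z R = symmetrize n (f * listZeta l) := by
  set K := symmetrize n (f * listZeta l) with hK
  obtain ⟨u, hu, huZ⟩ := exists_listZeta_mul_vandermonde hl.1
  obtain ⟨R₁, hR₁⟩ := mul_mem hf hu.2.1
  change subst z R₁ = _ at hR₁
  obtain ⟨N, g, hg⟩ := exists_aeval_eq_subst_mul R₁
  have hg := hg z
  rw [← toRat_eq_aeval, hR₁] at hg
  set M : RatFun n := ∏ x : VarIdx n, (z x : RatFun n) ^ N with hM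
  have hM0 : M ≠ 0 := Finset.prod_ne_zero_iff.2 fun x _ => pow_ne_zero _ (z x).ne_zero
  have hMσ : ∀ σ : ∀ i, Equiv.Perm (Fin (n i)), ratRename (permIdx σ).toEmbedding M = M := by
    intro σ
    rw [hM, map_prod]
    simp only [map_pow, ratRename_z]
    exact Fintype.prod_equiv (permIdx σ) _ _ fun x => rfl
  have hσ : ∀ σ : ∀ i, Equiv.Perm (Fin (n i)), ∃ Q : MvPolynomial (VarIdx n) (ParamField I),
      WheelOn Sigma.fst Finset.univ Q ∧
      ratRename (permIdx σ).toEmbedding (f * listZeta l) * M * toRat n (vandermonde Sigma.fst l) =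
        toRat n Q := by
    intro σ
    have hlσ := hl.map_equiv (permIdx σ)
    obtain ⟨v, hv⟩ := vandermonde_perm (Sigma.fst : VarIdx n → I)
      ((List.perm_ext_iff_of_nodup hlσ.1 hl.1).2 fun a => iff_of_true (hlσ.2 a) (hl.2 a))
    refine ⟨(MvPolynomial.rename (permIdx σ).toEmbedding g * v) *
      listPenalty Sigma.fst (l.map (permIdx σ).toEmbedding),
      (wheelOn_listPenalty fun x _ => hlσ.2 x).mul_left _, ?_⟩
    have h1 := congrArg (ratRename (permIdx σ).toEmbedding) hg
    have h2 := congrArg (ratRename (permIdx σ).toEmbedding) huZ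
    rw [map_mul, map_mul, hMσ, ratRename_toRat] at h1
    rw [map_mul, map_mul, ratRename_toRat, ratRename_toRat,
      rename_vandermonde (c := Sigma.fst) (c' := Sigma.fst) _ (fun _ => rfl),
      rename_listPenalty (c := Sigma.fst) (c' := Sigma.fst) _ (fun _ => rfl)] at h2
    rw [← hv, map_mul, map_mul, map_mul, map_mul, h1]
    linear_combination ratRename (permIdx σ).toEmbedding f * M *
      toRat n (v : MvPolynomial (VarIdx n) (ParamField I)) * h2
  choose Q hQw hQ using hσ
  have hKinv : ∀ σ : ∀ i, Equiv.Perm (Fin (n i)),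
      ratRename (permIdx σ).toEmbedding (K * M) = K * M := by
    intro σ
    rw [map_mul, hMσ, hK, ratRename_symmetrize]
  have hsum : K * M * toRat n (vandermonde Sigma.fst l) = toRat n (∑ σ, Q σ) := by
    rw [hK, symmetrize_apply, Finset.sum_mul, Finset.sum_mul, map_sum]
    exact Finset.sum_congr rfl fun σ _ => hQ σ
  obtain ⟨Q', hQ'⟩ := vandermonde_dvd_of_invariant hl.1 hKinv hsum
  have hKQ : K * M = toRat n Q' := by
    apply mul_right_cancel₀ (toRat_ne_zero (vandermonde_ne_zero hl.1))
    rw [hsum, hQ', map_mul, mul_comm]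
  have hwheel : WheelOn Sigma.fst Finset.univ Q' := by
    intro x hx y hy w hw hxw hxy hyw hc e
    have h1 := WheelOn.sum (fun σ (_ : σ ∈ Finset.univ) => hQw σ) x hx y hy w hw hxw hxy hyw hc e
    rw [hQ', map_mul] at h1
    exact (mul_eq_zero.1 h1).resolve_left
      (wheelSub_vandermonde_ne_zero _ (hasWeight_ratio e) hxy hl.1)
  obtain ⟨R, hR⟩ := exists_subst_mul_eq_aeval Q' N
  have hRK : subst z R = K := by
    have h1 := hR z
    rw [← toRat_eq_aeval, ← hKQ] at h1
    exact mul_right_cancel₀ hM0 h1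
  refine ⟨R, ⟨fun σ => ?_, (wheel_iff fun w => (hR w).symm).2 hwheel⟩, hRK⟩
  have h1 := ratRename_subst_z (permIdx σ).toEmbedding R
  rw [hRK, hK, ratRename_symmetrize, ← hK, ← hRK] at h1
  exact h1.symm

theorem mem_wordSpace_iff {F : RatFun n} :
    F ∈ wordSpace n ↔ ∃ R ∈ shuffleSpace n, subst z R = F := by
  constructor
  · intro h
    induction h using Submodule.span_induction with
    | zero => exact ⟨0, zero_mem _, map_zero _⟩
    | add F F' _ _ h h' =>
      obtain ⟨R, hR, rfl⟩ := h
      obtain ⟨R', hR', rfl⟩ := h'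
      exact ⟨R + R', add_mem hR hR', map_add _ _ _⟩
    | smul a F _ h =>
      obtain ⟨R, hR, rfl⟩ := h
      exact ⟨a • R, Submodule.smul_mem _ a hR, map_smul _ _ _⟩
    | mem F hF =>
      obtain ⟨f, hf, l, hl, rfl⟩ := hF
      exact exists_subst_eq_symmetrize hf hl
  · rintro ⟨R, hR, rfl⟩
    exact subst_mem_wordSpace hR

theorem shuffleMul_mem_wordSpace {F : RatFun n} {F' : RatFun m} (hF : F ∈ wordSpace n)
    (hF' : F' ∈ wordSpace m) : shuffleMul F F' ∈ wordSpace (n + m) := by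
  induction hF using Submodule.span_induction with
  | zero => simp [shuffleMul]
  | add F₁ F₂ _ _ h₁ h₂ =>
    have : shuffleMul (F₁ + F₂) F' = shuffleMul F₁ F' + shuffleMul F₂ F' := by
      simp [shuffleMul, add_mul]
    rw [this]
    exact add_mem h₁ h₂
  | smul a F _ h =>
    rw [shuffleMul_smul_left]
    exact Submodule.smul_mem _ a h
  | mem F hF =>
    obtain ⟨f, hf, l, hl, rfl⟩ := hF
    induction hF' using Submodule.span_induction with
    | zero => simp [shuffleMul]
    | add F₁ F₂ _ _ h₁ h₂ =>
      have : ∀ F : RatFun n, shuffleMul F (F₁ + F₂) = shuffleMul F F₁ + shuffleMul F F₂ := by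
        intro F
        simp [shuffleMul, mul_add, add_mul]
      rw [this]
      exact add_mem h₁ h₂
    | smul a F _ h =>
      rw [shuffleMul_smul_right]
      exact Submodule.smul_mem _ a h
    | mem F' hF' =>
      obtain ⟨f', hf', l', hl', rfl⟩ := hF'
      rw [shuffleMul_symmetrize_listZeta hl hl']
      exact Submodule.subset_span ⟨_, mul_mem (ratRename_mem_laurentRange _ hf)
        (ratRename_mem_laurentRange _ hf'), _, hl.append hl', rfl⟩

end WordsAreShuffles

/-! ### Words as products of generators, and the two inclusions. -/

section Generation

variable {I : Type u} [Quiver.{v} I] [Fintype I] [DecidableEq I] [∀ i j : I, Fintype (i ⟶ j)]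
  {n m : I → ℕ}

local notation "ℓ" => DirectSum.lof (ParamField I) (I → ℕ) (fun n => RatFun n)

theorem mem_shuffleAlgebra_iff {x : Ambient I} :
    x ∈ shuffleAlgebra I ↔ ∀ n, x n ∈ wordSpace n :=
  forall_congr' fun _ => mem_wordSpace_iff.symm

theorem lof_mem_shuffleAlgebra {F : RatFun n} (hF : F ∈ wordSpace n) :
    (ℓ n F : Ambient I) ∈ shuffleAlgebra I := by
  rw [mem_shuffleAlgebra_iff]
  intro m
  by_cases h : m = n
  · subst h
    rwa [DirectSum.lof_apply]
  · rw [DirectSum.lof_eq_of, DirectSum.of_eq_of_ne _ _ _ h]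
    exact zero_mem _

theorem mul_mem_shuffleAlgebra {x y : Ambient I} (hx : x ∈ shuffleAlgebra I)
    (hy : y ∈ shuffleAlgebra I) : x * y ∈ shuffleAlgebra I := by
  classical
  rw [mem_shuffleAlgebra_iff] at hx hy
  rw [← DirectSum.sum_support_of x, ← DirectSum.sum_support_of y, Finset.sum_mul_sum]
  refine sum_mem fun i _ => sum_mem fun j _ => ?_
  rw [← DirectSum.lof_eq_of (ParamField I), ← DirectSum.lof_eq_of (ParamField I), lof_mul_lof]
  exact lof_mem_shuffleAlgebra (shuffleMul_mem_wordSpace (hx i) (hy j))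

theorem single_le_one (i j : I) : (Pi.single i 1 : I → ℕ) j ≤ 1 := by
  rw [Pi.single_apply]
  split_ifs <;> simp

/-- The variable `z_{i1}` in degree `ς_i`. -/
abbrev genIdx (i : I) : VarIdx (Pi.single i 1 : I → ℕ) := ⟨i, ⟨0, by simp⟩⟩

theorem eq_genIdx {i : I} (x : VarIdx (Pi.single i 1 : I → ℕ)) : x = genIdx i := by
  obtain ⟨j, a⟩ := x
  have ha := a.2
  have hj : j = i := by
    by_contra h
    have := Pi.single_eq_of_ne (M := fun _ : I => ℕ) h 1
    omega
  subst hj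
  refine Sigma.ext rfl (heq_of_eq (Fin.ext ?_))
  exact Nat.lt_one_iff.1 (ha.trans_le (single_le_one j j))

theorem isOrdering_genIdx (i : I) : IsOrdering [genIdx i] :=
  ⟨List.nodup_singleton _, fun x => by rw [eq_genIdx x]; exact List.mem_singleton_self _⟩

theorem gen_eq (i : I) (d : ℤ) : gen i d = ℓ (Pi.single i 1)
    (symmetrize (Pi.single i 1) ((z (genIdx i) : RatFun (Pi.single i 1 : I → ℕ)) ^ d *
      listZeta [genIdx i])) := by
  rw [symmetrize_of_le_one (single_le_one i)]
  simp [listZeta, gen]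

theorem unit_eq : unit I = ℓ 0 (symmetrize 0 (1 * listZeta [])) := by
  rw [symmetrize_of_le_one (n := 0) (fun i => Nat.zero_le _)]
  simp [listZeta, unit]

theorem sphericalSubalgebra_le :
    (sphericalSubalgebra I).toSubmodule ≤ shuffleAlgebra I := by
  intro x hx
  change x ∈ NonUnitalAlgebra.adjoin _ _ at hx
  induction hx using NonUnitalAlgebra.adjoin_induction with
  | zero => exact zero_mem _
  | add x y _ _ hx hy => exact add_mem hx hy
  | mul x y _ _ hx hy => exact mul_mem_shuffleAlgebra hx hy
  | smul a x _ hx => exact Submodule.smul_mem _ a hx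
  | mem x hx =>
    rcases hx with rfl | ⟨⟨i, d⟩, rfl⟩
    · rw [unit_eq]
      refine lof_mem_shuffleAlgebra (Submodule.subset_span ⟨1, one_mem _, [], ⟨List.nodup_nil, ?_⟩, rfl⟩)
      rintro ⟨i, a⟩
      exact a.elim0
    · dsimp only
      rw [gen_eq]
      exact lof_mem_shuffleAlgebra (Submodule.subset_span
        ⟨_, z_zpow_mem_laurentRange _ d, _, isOrdering_genIdx i, rfl⟩)

theorem lof_symmetrize_cons {i : I} {l : List (VarIdx m)} (hl : IsOrdering l)
    (k : VarIdx (Pi.single i 1 + m : I → ℕ) → ℤ) :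
    (ℓ (Pi.single i 1 + m) (symmetrize (Pi.single i 1 + m)
      (((idxLeft _ m (genIdx i) :: l.map (idxRight (Pi.single i 1) m)).map fun x =>
        (z x : RatFun (Pi.single i 1 + m : I → ℕ)) ^ k x).prod *
        listZeta (idxLeft _ m (genIdx i) :: l.map (idxRight (Pi.single i 1) m)))) : Ambient I) =
    gen i (k (idxLeft _ m (genIdx i))) * ℓ m (symmetrize m
      ((l.map fun x => (z x : RatFun m) ^ k (idxRight (Pi.single i 1) m x)).prod *
        listZeta l)) := by
  rw [gen_eq, lof_mul_lof, shuffleMul_symmetrize_listZeta (isOrdering_genIdx i) hl]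
  congr 3
  rw [map_zpow₀, ratRename_z, map_list_prod, List.map_cons, List.prod_cons, List.map_map,
    List.map_map]
  congr 3
  funext y
  rw [Function.comp_apply, Function.comp_apply, map_zpow₀, ratRename_z]

/-- The symmetrization of a Laurent monomial times a product of functions `ζ'` is a product of
generators. -/
theorem lof_symmetrize_mem_spherical (l : List (VarIdx n)) (hl : IsOrdering l)
    (k : VarIdx n → ℤ) :
    (ℓ n (symmetrize n ((l.map fun x => (z x : RatFun n) ^ k x).prod * listZeta l)) : Ambient I) ∈
      sphericalSubalgebra I := by
  induction h : l.length generalizing n with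
  | zero =>
    rw [List.length_eq_zero_iff] at h
    subst h
    have hn : n = 0 := by
      funext i
      by_contra h0
      exact List.not_mem_nil (hl.2 ⟨i, ⟨0, Nat.pos_of_ne_zero h0⟩⟩)
    subst hn
    rw [List.map_nil, List.prod_nil, ← unit_eq]
    exact NonUnitalAlgebra.subset_adjoin _ (Set.mem_insert _ _)
  | succ N ih =>
    obtain ⟨x, l, rfl⟩ := List.exists_cons_of_length_eq_add_one h
    obtain ⟨i, hi⟩ : ∃ i, x.1 = i := ⟨_, rfl⟩
    obtain ⟨m, rfl⟩ : ∃ m : I → ℕ, n = Pi.single i 1 + m := by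
      refine ⟨n - Pi.single i 1, (add_tsub_cancel_of_le (a := (Pi.single i 1 : I → ℕ)) ?_).symm⟩
      intro j
      rw [Pi.single_apply]
      split_ifs with hj
      · subst hj hi
        exact Nat.one_le_iff_ne_zero.2 fun h0 => (finCongr h0 x.2).elim0
      · exact Nat.zero_le _
    -- The symmetrization does not see a permutation within color i, so the first letter may be
    -- moved to the slot of z_{i1} and split off as a generator. The remaining letters form an
    -- ordering in degree m.
    obtain ⟨σ, hσ⟩ := exists_permIdx_eq_swap (x := x) (y := idxLeft _ m (genIdx i)) hi
    have hσx : permIdx σ x = idxLeft _ m (genIdx i) := by rw [hσ, Equiv.swap_apply_left]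
    have hord := hl.map_equiv (permIdx σ)
    rw [List.map_cons, Equiv.coe_toEmbedding, hσx] at hord
    obtain ⟨l', hl'⟩ : ∃ l' : List (VarIdx m),
        l'.map (idxRight (Pi.single i 1) m) = l.map (permIdx σ) := by
      have : l.map (permIdx σ) ∈ Set.range (List.map (idxRight (Pi.single i 1) m)) := by
        rw [Set.range_list_map]
        intro y hy
        rcases idxLeft_or_idxRight y with ⟨v, rfl⟩ | h
        · rw [eq_genIdx v] at hy
          exact absurd hy (List.nodup_cons.1 hord.1).1
        · exact h
      exact this
    rw [← hl'] at hord
    have hord' : IsOrdering l' := by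
      refine ⟨(List.nodup_cons.1 hord.1).2.of_map _, fun y => ?_⟩
      have h1 := hord.2 (idxRight (Pi.single i 1) m y)
      rw [List.mem_cons] at h1
      have h2 := h1.resolve_left (idxLeft_ne_idxRight _ _).symm
      exact (List.mem_map_of_injective (idxRight (Pi.single i 1) m).injective).1 h2
    have hlen : l'.length = N := by
      have h1 := congrArg List.length hl'
      rw [List.length_map, List.length_map] at h1
      rw [h1]
      simpa using h
    have key := lof_symmetrize_cons hord' fun y => k ((permIdx σ).symm y)
    rw [← symmetrize_ratRename σ, map_mul, ratRename_listZeta _ (fun _ => rfl), map_list_prod,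
      List.map_map]
    have e : (ratRename (permIdx σ).toEmbedding ∘ fun x => (z x : RatFun (Pi.single i 1 + m)) ^ k x) =
        (fun y => (z y : RatFun (Pi.single i 1 + m)) ^ k ((permIdx σ).symm y)) ∘ permIdx σ := by
      funext y
      simp only [Function.comp_apply, map_zpow₀, ratRename_z, Equiv.coe_toEmbedding,
        Equiv.symm_apply_apply]
    rw [e, ← List.map_map, Equiv.coe_toEmbedding, List.map_cons, hσx, ← hl', key]
    refine mul_mem (NonUnitalAlgebra.subset_adjoin _ (Set.mem_insert_of_mem _ ⟨(i, _), rfl⟩)) ?_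
    exact ih l' hord' _ hlen

theorem lof_mem_spherical {F : RatFun n} (hF : F ∈ wordSpace n) :
    (ℓ n F : Ambient I) ∈ (sphericalSubalgebra I).toSubmodule := by
  induction hF using Submodule.span_induction with
  | zero =>
    rw [map_zero]
    exact zero_mem _
  | add F F' _ _ h h' =>
    rw [map_add]
    exact add_mem h h'
  | smul a F _ h =>
    rw [map_smul]
    exact Submodule.smul_mem _ a h
  | mem F hF =>
    obtain ⟨_, ⟨R, rfl⟩, l, hl, rfl⟩ := hF
    change (ℓ n (symmetrize n (subst z R * listZeta l)) : Ambient I) ∈ _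
    induction R using AddMonoidAlgebra.induction_linear with
    | zero =>
      rw [map_zero, zero_mul, map_zero, map_zero]
      exact zero_mem _
    | add R R' h h' =>
      rw [map_add, add_mul, map_add, map_add]
      exact add_mem h h'
    | single k a =>
      rw [subst_single, ← hl.prod_eq, mul_assoc, ← Algebra.smul_def, map_smul, map_smul]
      exact Submodule.smul_mem _ a (lof_symmetrize_mem_spherical l hl k)

end Generation
end QuiverShuffle

theorem theorem3p3 {I : Type u} [Fintype I] [DecidableEq I] [Quiver.{v} I]
    [∀ i j : I, Fintype (i ⟶ j)] :
    (QuiverShuffle.sphericalSubalgebra I).toSubmodule = QuiverShuffle.shuffleAlgebra I := by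
  classical
  refine le_antisymm QuiverShuffle.sphericalSubalgebra_le fun x hx => ?_
  rw [QuiverShuffle.mem_shuffleAlgebra_iff] at hx
  rw [← DirectSum.sum_support_of x]
  refine sum_mem fun n _ => ?_
  rw [← DirectSum.lof_eq_of (QuiverShuffle.ParamField I)]
  exact QuiverShuffle.lof_mem_spherical (hx n)
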